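/- Let $G$ be a second-countable unimodular locally compact (Hausdorff) group with Haar measure $\mu_G$, and let $Q \subseteq G$ be a fixed compact symmetric neighbourhood of the identity. Let $(\pi, \mathcal{H}_\pi)$ be a discrete series representation of $G$: a strongly measurable map $\pi$ from $G$ into the unitary operators of a complex Hilbert space $\mathcal{H}_\pi$ with $\pi(xy) = \sigma(x,y)\pi(x)\pi(y)$ for some $\sigma : G \times G \to \mathbb{T}$, such that $\{0\}$ and $\mathcal{H}_\pi$ are the only closed $\pi$-invariant subspaces, and such that $\int_G |\langle f, \pi(x) f\rangle|^2 \, d\mu_G(x) < \infty$ for some $f \neq 0$. Let $0 \ne g \in \mathcal{B}^2_\pi$; that is, the function $F(x) = \langle g, \pi(x) g\rangle$ lies in $L^\infty_{\mathrm{loc}}(G)$ and its local maximal function $M^L F(x) = \operatorname{ess\,sup}_{z \in Q} |F(xz)|$ lies in $L^2(G)$. Let $\Lambda \subseteq G$ be discrete and suppose that $\pi(\Lambda) g = (\pi(\lambda) g)_{\lambda \in \Lambda}$ is a frame for $\mathcal{H}_\pi$: there are $A, B > 0$ with $A\|f\|^2 \le \sum_{\lambda \in \Lambda} |\langle f, \pi(\lambda)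 g\rangle|^2 \le B \|f\|^2$ for all $f \in \mathcal{H}_\pi$. Let $h_\lambda = S^{-1}\pi(\lambda) g$ be its canonical dual frame, where $S f = \sum_{\lambda \in \Lambda} \langle f, \pi(\lambda) g\rangle \pi(\lambda) g$. A strong Følner sequence is a sequence $(K_n)_{n\in\mathbb{N}}$ of compact subsets of $G$ of positive measure such that, for every non-empty compact $K \subseteq G$, $$\lim_{n\to\infty} \frac{\mu_G(K_n K \,\Delta\, K_n)}{\mu_G(K_n)} = 0 \quad\text{and}\quad \lim_{n\to\infty} \frac{\mu_G(K_n K \cap K_n^c K)}{\mu_G(K_n)} = 0 .$$ Then there are real numbers $M^-$ and $M^+$ such that, for every strong Følner sequence $(K_n)_{n \in \mathbb{N}}$ in $G$, the set $\Lambda \cap xK_n$ is finite and non-empty for all $x \in G$ once $n$ is large enough, both of the following limits exist, and $$\lim_{n \to \infty} \inf_{x \in G} \frac{1}{\#(\Lambda \cap xK_n)} \sum_{\lambda \in \Lambda \cap xK_n} \langle \pi(\lambda) g, h_\lambda\rangle = M^-, \qquad \lim_{n \to \infty} \sup_{x \in G} \frac{1}{\#(\Lambda \cap xK_n)} \sum_{\lambda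 \in \Lambda \cap xK_n} \langle \pi(\lambda) g, h_\lambda\rangle = M^+ .$$ That is, the lower and upper frame measures of $\pi(\Lambda) g$ do not depend on the choice of strong Følner sequence. -/

import Mathlib

open MeasureTheory Filter Topology
open scoped Pointwise ENNReal symmDiff

namespace CoherentFrame

/-- A (right) strong Følner sequence in `G`: non-null compact sets `K n` such that
`μ (K n * L ∆ K n) / μ (K n) → 0` and `μ (K n * L ∩ (K n)ᶜ * L) / μ (K n) → 0` for every
non-empty compact set `L`. -/
structure IsStrongFolner {G : Type*} [Group G] [TopologicalSpace G] [MeasurableSpace G]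
    (μ : Measure G) (K : ℕ → Set G) : Prop where
  isCompact : ∀ n, IsCompact (K n)
  nonnull : ∀ n, 0 < μ (K n)
  folner : ∀ L : Set G, IsCompact L → L.Nonempty →
    Tendsto (fun n => μ ((K n * L) ∆ K n) / μ (K n)) atTop (𝓝 0)
  strong : ∀ L : Set G, IsCompact L → L.Nonempty →
    Tendsto (fun n => μ ((K n * L) ∩ ((K n)ᶜ * L)) / μ (K n)) atTop (𝓝 0)

/-- The left-sided local maximal function
`M^L F (x) = ess sup_{z ∈ Q} |F (x z)|`, with values in `[0, ∞]`. -/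
noncomputable def localMax {G : Type*} [Group G] [MeasurableSpace G]
    (μ : Measure G) (Q : Set G) (F : G → ℂ) (x : G) : ℝ≥0∞ :=
  essSup (fun z => ‖F (x * z)‖ₑ) (μ.restrict Q)

/-- The left-sided Wiener amalgam space `W^L(L^p)`: functions in `L^∞_loc` whose local maximal
function belongs to `L^p`. -/
def wienerAmalgam {G : Type*} [Group G] [TopologicalSpace G] [MeasurableSpace G]
    (μ : Measure G) (Q : Set G) (p : ℝ≥0∞) : Set (G → ℂ) :=
  {F | (∀ L : Set G, IsCompact L → MemLp F ∞ (μ.restrict L)) ∧ MemLp (localMax μ Q F) p μ}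

section Representation

variable {G H : Type*} [NormedAddCommGroup H] [InnerProductSpace ℂ H]

/-- A projective unitary representation: a map into the unitary operators, measurable for the
strong operator topology and multiplicative up to a `𝕋`-valued function. -/
structure IsProjectiveRep [Group G] [MeasurableSpace G] (π : G → H ≃ₗᵢ[ℂ] H) : Prop where
  map_mul : ∃ σ : G → G → Circle, ∀ x y f, π (x * y) f = (σ x y : ℂ) • π x (π y f)
  stronglyMeasurable : ∀ f, StronglyMeasurable fun x => π x f

/-- The only closed invariant subspaces are `{0}` and the whole space. -/
def IsIrreducibleRep (π : G → H ≃ₗᵢ[ℂ] H) : Prop :=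
  ∀ V : Submodule ℂ H, IsClosed (V : Set H) → (∀ x, ∀ v ∈ V, π x v ∈ V) → V = ⊥ ∨ V = ⊤

/-- The coefficient transform `V_g f (x) = ⟨f, π x g⟩`, where `⟨·, ·⟩` is linear in its first
argument (so that the two arguments of Mathlib's `inner` are exchanged). -/
noncomputable def coeff (π : G → H ≃ₗᵢ[ℂ] H) (g f : H) (x : G) : ℂ :=
  inner ℂ (π x g) f

/-- A discrete series representation: an irreducible projective unitary representation with a
non-zero square-integrable vector. -/
structure IsDiscreteSeries [Group G] [MeasurableSpace G] (μ : Measure G)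
    (π : G → H ≃ₗᵢ[ℂ] H) : Prop where
  projective : IsProjectiveRep π
  irreducible : IsIrreducibleRep π
  squareIntegrable : ∃ g : H, g ≠ 0 ∧ MemLp (coeff π g g) 2 μ

/-- The space `B²_π` of all vectors `g` with `V_g g ∈ W^L(L²)`. -/
def B2 [Group G] [TopologicalSpace G] [MeasurableSpace G] (μ : Measure G) (Q : Set G)
    (π : G → H ≃ₗᵢ[ℂ] H) : Set H :=
  {g | coeff π g g ∈ wienerAmalgam μ Q 2}

/-- `(π l g)_{l ∈ Λ}` is a frame:
`A ‖f‖² ≤ ∑_{l ∈ Λ} |⟨f, π l g⟩|² ≤ B ‖f‖²` for all `f`, for some `A, B > 0`. -/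
def IsCoherentFrame (π : G → H ≃ₗᵢ[ℂ] H) (g : H) (Λ : Set G) : Prop :=
  ∃ A B : ℝ, 0 < A ∧ 0 < B ∧ ∀ f : H,
    Summable (fun l : Λ => ‖coeff π g f l‖ ^ 2) ∧
    A * ‖f‖ ^ 2 ≤ ∑' l : Λ, ‖coeff π g f l‖ ^ 2 ∧
    ∑' l : Λ, ‖coeff π g f l‖ ^ 2 ≤ B * ‖f‖ ^ 2

/-- The frame operator `f ↦ ∑_{l ∈ Λ} ⟨f, π l g⟩ π l g`. For a frame the series converges
unconditionally for every `f`. -/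
noncomputable def frameOperator (π : G → H ≃ₗᵢ[ℂ] H) (g : H) (Λ : Set G) (f : H) : H :=
  ∑' l : Λ, coeff π g f l • π l g

/-- The canonical dual frame `h_l = S⁻¹ (π l g)`, where `S` is the frame operator. For a frame
`S` is bijective, and `Function.invFun` is its inverse. -/
noncomputable def canonicalDual (π : G → H ≃ₗᵢ[ℂ] H) (g : H) (Λ : Set G) (l : G) : H :=
  Function.invFun (frameOperator π g Λ) (π l g)

/-- The average `#(Λ ∩ E)⁻¹ ∑_{l ∈ Λ ∩ E} ⟨π l g, h_l⟩`. For a frame each `⟨π l g, h_l⟩` is a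
real number (in `[0, 1]`), so that taking the real part changes nothing; and `Λ ∩ E` is finite
for every relatively compact `E`. -/
noncomputable def frameAverage (π : G → H ≃ₗᵢ[ℂ] H) (g : H) (Λ : Set G) (E : Set G) : ℝ :=
  ((Λ ∩ E).ncard : ℝ)⁻¹ *
    ∑ᶠ l ∈ Λ ∩ E, (inner ℂ (canonicalDual π g Λ l) (π l g)).re

/-- The lower frame measure along `K` exists and equals `M`:
`M = lim_n inf_x #(Λ ∩ x K_n)⁻¹ ∑_{l ∈ Λ ∩ x K_n} ⟨π l g, h_l⟩`. -/
def HasLowerFrameMeasure [Group G] (π : G → H ≃ₗᵢ[ℂ] H) (g : H) (Λ : Set G)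
    (K : ℕ → Set G) (M : ℝ) : Prop :=
  Tendsto (fun n => ⨅ x : G, frameAverage π g Λ (x • K n)) atTop (𝓝 M)

/-- The upper frame measure along `K` exists and equals `M`:
`M = lim_n sup_x #(Λ ∩ x K_n)⁻¹ ∑_{l ∈ Λ ∩ x K_n} ⟨π l g, h_l⟩`. -/
def HasUpperFrameMeasure [Group G] (π : G → H ≃ₗᵢ[ℂ] H) (g : H) (Λ : Set G)
    (K : ℕ → Set G) (M : ℝ) : Prop :=
  Tendsto (fun n => ⨆ x : G, frameAverage π g Λ (x • K n)) atTop (𝓝 M)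

end Representation

end CoherentFrame

/-!
By Schur's lemma, square-integrability of `V_g g` makes `V_g` a multiple of an isometry:
`∫ |V_g f|² = c ‖f‖²`. Integrating `‖π y g‖² = ∑_{l ∈ Λ} ⟨π y g, π l g⟩ ⟨h_l, π y g⟩` over `y ∈ E`
and comparing with the integral over the whole group of the summands with `l ∈ Λ ∩ E` gives
`‖g‖² μ(E) ≈ c ∑_{l ∈ Λ ∩ E} ⟨π l g, h_l⟩`. Up to a small `L²`-error, which the amalgam condition
on `V_g g` keeps uniform, the difference comes from the points within a fixed compact set of the
boundary of `E`, hence is negligible for `E = x K_n`. So the frame average over `Λ ∩ x K_n`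
multiplied by the density `#(Λ ∩ x K_n) / μ(K_n)` tends to `‖g‖² / c`, uniformly in `x`.

It remains to see that the extreme densities converge to limits independent of the sequence: by
averaging over translates, the infimum over `x` of `#(Λ ∩ x K) / μ(K)` for a fixed compact `K`
is asymptotically at most that for `K_n`. Hence the lower density along `(K_n)` is the supremum
of these infima over all compact `K`, and dually for the upper density.
-/

namespace CoherentFrame

open scoped ComplexConjugate

section Schur

variable {G H : Type*} [NormedAddCommGroup H] [InnerProductSpace ℂ H] {π : G → H ≃ₗᵢ[ℂ] H}

theorem IsIrreducibleRep.ker_eq_bot_or_eq_zero (hπ : IsIrreducibleRep π) {T : H →L[ℂ] H}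
    (hT : ∀ x v, T (π x v) = π x (T v)) : T.ker = ⊥ ∨ T = 0 := by
  refine (hπ T.ker T.isClosed_ker fun x v hv => ?_).imp_right fun h => ?_
  · have hv : T v = 0 := hv
    change T (π x v) = 0
    rw [hT, hv, map_zero]
  · ext v
    exact (h ▸ Submodule.mem_top : v ∈ T.ker)

theorem cfc_ne_zero_of_mem_spectrum [CompleteSpace H] {T : H →L[ℂ] H} (hT : IsSelfAdjoint T)
    {f : ℝ → ℝ} (hf : Continuous f) {t : ℝ} (ht : t ∈ spectrum ℝ T) (hft : f t ≠ 0) :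
    cfc f T ≠ 0 := fun h =>
  hft <| (cfc_eq_cfc_iff_eqOn hT hf.continuousOn continuousOn_const).1
    (h.trans (cfc_const_zero ℝ T).symm) ht

theorem IsIrreducibleRep.spectrum_subsingleton [CompleteSpace H] (hπ : IsIrreducibleRep π)
    {T : H →L[ℂ] H} (hT : IsSelfAdjoint T) (hc : ∀ x v, T (π x v) = π x (T v)) :
    (spectrum ℝ T).Subsingleton := by
  suffices h : ∀ s ∈ spectrum ℝ T, ∀ t ∈ spectrum ℝ T, ¬ s < t from fun s hs t ht =>
    le_antisymm (not_lt.1 (h t ht s hs)) (not_lt.1 (h s hs t ht))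
  intro s hs t ht hst
  obtain ⟨m, hsm, hmt⟩ := exists_between hst
  -- Two functions with product `0`, neither of which vanishes on the spectrum.
  let φ : ℝ → ℝ := fun r => max (m - r) 0
  let ψ : ℝ → ℝ := fun r => max (r - m) 0
  have hφ : Continuous φ := by fun_prop
  have hψ : Continuous ψ := by fun_prop
  have hφψ : cfc φ T * cfc ψ T = 0 := by
    rw [← cfc_mul φ ψ T hφ.continuousOn hψ.continuousOn, ← cfc_const_zero ℝ T]
    congr 1 with r
    rcases le_total r m with hr | hr <;> simp [φ, ψ, hr]
  have hφ0 : cfc φ T ≠ 0 := cfc_ne_zero_of_mem_spectrum hT hφ hs (by simp [φ, hsm])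
  have hψ0 : cfc ψ T ≠ 0 := cfc_ne_zero_of_mem_spectrum hT hψ ht (by simp [ψ, hmt])
  have hφc : ∀ x v, cfc φ T (π x v) = π x (cfc φ T v) := fun x v => by
    have hcomm : Commute T ((π x).toContinuousLinearEquiv : H →L[ℂ] H) := by
      ext v
      exact hc x v
    exact DFunLike.congr_fun (hcomm.cfc_real φ).eq v
  have hker := (hπ.ker_eq_bot_or_eq_zero hφc).resolve_right hφ0
  refine hψ0 (ContinuousLinearMap.ext fun v => ?_)
  have hv : cfc ψ T v ∈ (cfc φ T).ker := DFunLike.congr_fun hφψ v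
  simpa [hker] using hv

theorem IsIrreducibleRep.exists_eq_smul [CompleteSpace H] (hπ : IsIrreducibleRep π)
    {T : H →L[ℂ] H} (hT : IsSelfAdjoint T) (hc : ∀ x v, T (π x v) = π x (T v)) :
    ∃ t : ℝ, ∀ v, T v = (t : ℂ) • v := by
  rcases subsingleton_or_nontrivial H with h | h
  · exact ⟨0, fun v => Subsingleton.elim _ _⟩
  obtain ⟨t, ht⟩ := ContinuousFunctionalCalculus.spectrum_nonempty (R := ℝ) T hT
  have hT_eq : T = algebraMap ℝ _ t := calc
    T = cfc (id : ℝ → ℝ) T := (cfc_id ℝ T).symm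
    _ = cfc (fun _ : ℝ => t) T :=
      cfc_congr fun s hs => hπ.spectrum_subsingleton hT hc hs ht
    _ = algebraMap ℝ _ t := cfc_const t T
  exact ⟨t, fun v => by simp [hT_eq, Algebra.algebraMap_eq_smul_one]⟩

end Schur

section Coefficients

variable {G H : Type*} [NormedAddCommGroup H] [InnerProductSpace ℂ H] {π : G → H ≃ₗᵢ[ℂ] H}

theorem coeff_add (g u v : H) : coeff π g (u + v) = coeff π g u + coeff π g v := by
  funext x; simp [coeff]

theorem coeff_smul (c : ℂ) (g u : H) : coeff π g (c • u) = c • coeff π g u := by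
  funext x; simp [coeff]

variable [Group G] [MeasurableSpace G]

theorem IsProjectiveRep.exists_symm_apply (hπ : IsProjectiveRep π) (x y : G) :
    ∃ s : Circle, ∀ f, (π x).symm (π y f) = (s : ℂ) • π (x⁻¹ * y) f := by
  obtain ⟨σ, hσ⟩ := hπ.map_mul
  refine ⟨σ x (x⁻¹ * y), fun f => ?_⟩
  have h := hσ x (x⁻¹ * y) f
  rw [mul_inv_cancel_left] at h
  rw [h, map_smul, LinearIsometryEquiv.symm_apply_apply]

theorem IsProjectiveRep.conj_coeff_mul_coeff (hπ : IsProjectiveRep π) (g u v : H) (x y : G) :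
    conj (coeff π g (π x u) y) * coeff π g v y =
      conj (coeff π g u (x⁻¹ * y)) * coeff π g ((π x).symm v) (x⁻¹ * y) := by
  obtain ⟨s, hs⟩ := hπ.exists_symm_apply x y
  have hu : coeff π g (π x u) y = conj (s : ℂ) * coeff π g u (x⁻¹ * y) := by
    rw [coeff, ← (π x).symm.inner_map_map, LinearIsometryEquiv.symm_apply_apply, hs,
      inner_smul_left, coeff]
  have hv : coeff π g v y = conj (s : ℂ) * coeff π g ((π x).symm v) (x⁻¹ * y) := by
    rw [coeff, ← (π x).symm.inner_map_map, hs, inner_smul_left, coeff]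
  have hs1 : (s : ℂ) * conj (s : ℂ) = 1 := by simp [Complex.mul_conj]
  rw [hu, hv, _root_.map_mul, Complex.conj_conj]
  linear_combination
    conj (coeff π g u (x⁻¹ * y)) * coeff π g ((π x).symm v) (x⁻¹ * y) * hs1

theorem IsProjectiveRep.norm_coeff_apply (hπ : IsProjectiveRep π) (g f : H) (x y : G) :
    ‖coeff π g (π x f) y‖ = ‖coeff π g f (x⁻¹ * y)‖ := by
  have h := congrArg norm (hπ.conj_coeff_mul_coeff g f (π x f) x y)
  simp only [LinearIsometryEquiv.symm_apply_apply, norm_mul, RCLike.norm_conj] at h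
  exact (mul_self_inj (norm_nonneg _) (norm_nonneg _)).1 h

theorem IsProjectiveRep.norm_coeff_symm_apply (hπ : IsProjectiveRep π) (g f : H) (x y : G) :
    ‖coeff π g ((π x).symm f) y‖ = ‖coeff π g f (x * y)‖ := by
  simpa using (hπ.norm_coeff_apply g ((π x).symm f) x (x * y)).symm

theorem IsProjectiveRep.norm_coeff_apply_self (hπ : IsProjectiveRep π) (g : H) (x y : G) :
    ‖coeff π g (π x g) y‖ = ‖coeff π g g (y⁻¹ * x)‖ := by
  rw [← hπ.norm_coeff_apply, coeff, coeff, norm_inner_symm]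

theorem IsProjectiveRep.stronglyMeasurable_coeff (hπ : IsProjectiveRep π) (g f : H) :
    StronglyMeasurable (coeff π g f) :=
  (hπ.stronglyMeasurable g).inner stronglyMeasurable_const

end Coefficients

section L2

variable {X : Type*} [MeasurableSpace X] {μ : Measure X} {a b : X → ℂ}

theorem integral_conj_mul_eq_inner (ha : MemLp a 2 μ) (hb : MemLp b 2 μ) :
    ∫ x, conj (a x) * b x ∂μ = inner ℂ (ha.toLp a) (hb.toLp b) := by
  rw [L2.inner_def]
  refine integral_congr_ae ?_
  filter_upwards [ha.coeFn_toLp, hb.coeFn_toLp] with x hax hbx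
  rw [hax, hbx, RCLike.inner_apply, mul_comm]

theorem integrable_conj_mul (ha : MemLp a 2 μ) (hb : MemLp b 2 μ) :
    Integrable (fun x => conj (a x) * b x) μ :=
  (ha.star : MemLp (fun x => conj (a x)) 2 μ).integrable_mul hb

theorem integral_conj_mul_self (a : X → ℂ) :
    ∫ x, conj (a x) * a x ∂μ = ((∫ x, ‖a x‖ ^ 2 ∂μ : ℝ) : ℂ) := by
  simp_rw [Complex.conj_mul', ← Complex.ofReal_pow]
  exact integral_complex_ofReal

theorem integrable_norm_sq (ha : MemLp a 2 μ) : Integrable (fun x => ‖a x‖ ^ 2) μ :=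
  (memLp_two_iff_integrable_sq_norm ha.1).1 ha

theorem norm_toLp_sq (ha : MemLp a 2 μ) : ‖ha.toLp a‖ ^ 2 = ∫ x, ‖a x‖ ^ 2 ∂μ := by
  have h := integral_conj_mul_eq_inner ha ha
  rw [integral_conj_mul_self, inner_self_eq_norm_sq_to_K] at h
  exact Complex.ofReal_injective (by push_cast; exact h.symm)

theorem norm_integral_conj_mul_le (ha : MemLp a 2 μ) (hb : MemLp b 2 μ) :
    ‖∫ x, conj (a x) * b x ∂μ‖ ≤ √(∫ x, ‖a x‖ ^ 2 ∂μ) * √(∫ x, ‖b x‖ ^ 2 ∂μ) := by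
  rw [integral_conj_mul_eq_inner ha hb, ← norm_toLp_sq ha, ← norm_toLp_sq hb,
    Real.sqrt_sq (norm_nonneg _), Real.sqrt_sq (norm_nonneg _)]
  exact norm_inner_le_norm _ _

end L2

section Orthogonality

variable {G H : Type*} [MeasurableSpace G] [NormedAddCommGroup H] [InnerProductSpace ℂ H]

/-- The graph of the coefficient transform `V_g`, viewed as a possibly unbounded operator into
`L²(μ)` with its natural domain. -/
noncomputable def coeffGraph (π : G → H ≃ₗᵢ[ℂ] H) (g : H) (μ : Measure G) :
    Submodule ℂ (WithLp 2 (H × Lp ℂ 2 μ)) where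
  carrier := {p | p.snd =ᵐ[μ] coeff π g p.fst}
  zero_mem' := by
    have h : coeff π g (0 : H) = 0 := by funext x; simp [coeff]
    simp only [Set.mem_ofPred_eq, WithLp.zero_fst, WithLp.zero_snd, h]
    exact Lp.coeFn_zero _ _ _
  add_mem' hp hq := by
    simp only [Set.mem_ofPred_eq, WithLp.add_fst, WithLp.add_snd, coeff_add] at *
    exact (Lp.coeFn_add _ _).trans (hp.add hq)
  smul_mem' c p hp := by
    simp only [Set.mem_ofPred_eq, WithLp.smul_fst, WithLp.smul_snd, coeff_smul] at *
    exact (Lp.coeFn_smul _ _).trans (hp.const_smul c)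

variable {π : G → H ≃ₗᵢ[ℂ] H} {g : H} {μ : Measure G}

theorem toLp_mem_coeffGraph {f : H} (hf : MemLp (coeff π g f) 2 μ) :
    WithLp.toLp 2 (f, hf.toLp _) ∈ coeffGraph π g μ :=
  hf.coeFn_toLp

theorem memLp_of_mem_coeffGraph {p : WithLp 2 (H × Lp ℂ 2 μ)} (hp : p ∈ coeffGraph π g μ) :
    MemLp (coeff π g p.fst) 2 μ :=
  (memLp_congr_ae hp).1 (Lp.memLp _)

theorem inner_of_mem_coeffGraph {p q : WithLp 2 (H × Lp ℂ 2 μ)} (hp : p ∈ coeffGraph π g μ)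
    (hq : q ∈ coeffGraph π g μ) :
    inner ℂ p q =
      inner ℂ p.fst q.fst + ∫ y, conj (coeff π g p.fst y) * coeff π g q.fst y ∂μ := by
  rw [WithLp.prod_inner_apply, L2.inner_def]
  congr 1
  refine integral_congr_ae ?_
  filter_upwards [hp, hq] with y hpy hqy
  change inner ℂ (p.snd y) (q.snd y) = _
  rw [hpy, hqy, RCLike.inner_apply, mul_comm]

theorem isClosed_coeffGraph (π : G → H ≃ₗᵢ[ℂ] H) (g : H) (μ : Measure G) :
    IsClosed (coeffGraph π g μ : Set (WithLp 2 (H × Lp ℂ 2 μ))) := by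
  refine IsSeqClosed.isClosed fun u p hu hup => ?_
  have hfst : Tendsto (fun n => (u n).fst) atTop (𝓝 p.fst) :=
    (WithLp.continuous_fst 2 _ _).continuousAt.tendsto.comp hup
  have hsnd : Tendsto (fun n => (u n).snd) atTop (𝓝 p.snd) :=
    (WithLp.continuous_snd 2 _ _).continuousAt.tendsto.comp hup
  obtain ⟨ns, hns, hae⟩ := (tendstoInMeasure_of_tendsto_Lp hsnd).exists_seq_tendsto_ae
  have hgraph : ∀ᵐ x ∂μ, ∀ n, (u n).snd x = coeff π g (u n).fst x := ae_all_iff.2 hu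
  change p.snd =ᵐ[μ] coeff π g p.fst
  filter_upwards [hae, hgraph] with x hlim hx
  simp only [hx, coeff] at hlim
  exact tendsto_nhds_unique hlim (tendsto_const_nhds.inner (hfst.comp hns.tendsto_atTop))

theorem inner_toLp_zero_left (f : H) (p : WithLp 2 (H × Lp ℂ 2 μ)) :
    inner ℂ (WithLp.toLp 2 (f, (0 : Lp ℂ 2 μ))) p = inner ℂ f p.fst := by
  simp [WithLp.prod_inner_apply]

theorem inner_toLp_zero_right (f : H) (p : WithLp 2 (H × Lp ℂ 2 μ)) :
    inner ℂ p (WithLp.toLp 2 (f, (0 : Lp ℂ 2 μ))) = inner ℂ p.fst f := by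
  simp [WithLp.prod_inner_apply]

variable [CompleteSpace H]

instance : (coeffGraph π g μ).HasOrthogonalProjection :=
  have := (isClosed_coeffGraph π g μ).completeSpace_coe
  inferInstance

variable (π g μ) in
/-- The bounded operator `(1 + V_g* V_g)⁻¹`, constructed as the compression to `H` of the
orthogonal projection onto the graph of `V_g` (so that no density of the domain is required). -/
noncomputable def coeffResolvent : H →L[ℂ] H :=
  WithLp.fstL 2 ℂ H (Lp ℂ 2 μ) ∘L (coeffGraph π g μ).starProjection ∘L
    ((WithLp.prodContinuousLinearEquiv 2 ℂ H (Lp ℂ 2 μ)).symm : _ →L[ℂ] _) ∘L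
      ContinuousLinearMap.inl ℂ H (Lp ℂ 2 μ)

theorem coeffResolvent_apply (f : H) :
    coeffResolvent π g μ f =
      ((coeffGraph π g μ).starProjection (WithLp.toLp 2 (f, (0 : Lp ℂ 2 μ)))).fst :=
  rfl

theorem isSelfAdjoint_coeffResolvent : IsSelfAdjoint (coeffResolvent π g μ) := by
  refine ContinuousLinearMap.isSelfAdjoint_iff_isSymmetric.2 fun f f' => ?_
  change inner ℂ (coeffResolvent π g μ f) f' = inner ℂ f (coeffResolvent π g μ f')
  rw [coeffResolvent_apply, coeffResolvent_apply, ← inner_toLp_zero_right,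
    ← inner_toLp_zero_left]
  exact (coeffGraph π g μ).inner_starProjection_left_eq_right _ _

theorem memLp_coeff_coeffResolvent (f : H) :
    MemLp (coeff π g (coeffResolvent π g μ f)) 2 μ :=
  memLp_of_mem_coeffGraph ((coeffGraph π g μ).starProjection_apply_mem _)

theorem inner_eq_inner_coeffResolvent_add (f : H) {d : H} (hd : MemLp (coeff π g d) 2 μ) :
    inner ℂ f d = inner ℂ (coeffResolvent π g μ f) d +
      ∫ y, conj (coeff π g (coeffResolvent π g μ f) y) * coeff π g d y ∂μ := by
  have h := (coeffGraph π g μ).starProjection_inner_eq_zero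
    (WithLp.toLp 2 (f, (0 : Lp ℂ 2 μ))) _ (toLp_mem_coeffGraph hd)
  rw [inner_sub_left, sub_eq_zero, inner_toLp_zero_left, inner_of_mem_coeffGraph
    ((coeffGraph π g μ).starProjection_apply_mem _) (toLp_mem_coeffGraph hd)] at h
  exact h

theorem coeffResolvent_eq {f u : H} (hu : MemLp (coeff π g u) 2 μ)
    (h : ∀ d, MemLp (coeff π g d) 2 μ →
      inner ℂ f d = inner ℂ u d + ∫ y, conj (coeff π g u y) * coeff π g d y ∂μ) :
    coeffResolvent π g μ f = u := by
  refine congrArg WithLp.fst (Submodule.eq_starProjection_of_mem_of_inner_eq_zero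
    (toLp_mem_coeffGraph hu) fun p hp => ?_)
  change inner ℂ (WithLp.toLp 2 (f, (0 : Lp ℂ 2 μ)) - WithLp.toLp 2 (u, hu.toLp _)) p = 0
  rw [inner_sub_left, inner_toLp_zero_left, inner_of_mem_coeffGraph (toLp_mem_coeffGraph hu) hp,
    sub_eq_zero]
  exact h p.fst (memLp_of_mem_coeffGraph hp)

end Orthogonality

section Admissible

variable {G H : Type*} [MeasurableSpace G] [NormedAddCommGroup H] [InnerProductSpace ℂ H]

/-- The vector `g` is admissible with constant `c`: the coefficient transform `V_g` is `√c` times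
an isometry of `H` into `L²(μ)`. For a discrete series, `c` is `‖g‖²` divided by the formal
dimension of `π`. -/
structure IsAdmissible (μ : Measure G) (π : G → H ≃ₗᵢ[ℂ] H) (g : H) (c : ℝ) : Prop where
  pos : 0 < c
  memLp_coeff : ∀ f, MemLp (coeff π g f) 2 μ
  integral_norm_coeff_sq : ∀ f, ∫ y, ‖coeff π g f y‖ ^ 2 ∂μ = c * ‖f‖ ^ 2

variable {π : G → H ≃ₗᵢ[ℂ] H} {g : H} {c : ℝ} {μ : Measure G}

/-- The coefficient transform of an admissible vector as a linear map into `L²(μ)`. -/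
noncomputable def IsAdmissible.toLp (hc : IsAdmissible μ π g c) : H →ₗ[ℂ] Lp ℂ 2 μ where
  toFun f := (hc.memLp_coeff f).toLp _
  map_add' u v := (MemLp.toLp_congr _ ((hc.memLp_coeff u).add (hc.memLp_coeff v))
    (by rw [coeff_add])).trans (MemLp.toLp_add _ _)
  map_smul' s u := (MemLp.toLp_congr _ ((hc.memLp_coeff u).const_smul s)
    (by rw [coeff_smul])).trans (MemLp.toLp_const_smul s _)

theorem IsAdmissible.norm_toLp_sq (hc : IsAdmissible μ π g c) (f : H) :
    ‖hc.toLp f‖ ^ 2 = c * ‖f‖ ^ 2 :=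
  (CoherentFrame.norm_toLp_sq (hc.memLp_coeff f)).trans (hc.integral_norm_coeff_sq f)

theorem IsAdmissible.integral_conj_coeff_mul_coeff (hc : IsAdmissible μ π g c) (u v : H) :
    ∫ y, conj (coeff π g u y) * coeff π g v y ∂μ = c * inner ℂ u v := by
  have hnorm : ∀ f, (‖hc.toLp f‖ : ℂ) ^ 2 = c * (‖f‖ : ℂ) ^ 2 := fun f => by
    exact_mod_cast hc.norm_toLp_sq f
  rw [integral_conj_mul_eq_inner (hc.memLp_coeff u) (hc.memLp_coeff v)]
  change inner ℂ (hc.toLp u) (hc.toLp v) = _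
  rw [inner_eq_sum_norm_sq_div_four u v, inner_eq_sum_norm_sq_div_four (hc.toLp u)]
  simp only [← map_smul, ← map_add, ← map_sub, Complex.coe_algebraMap, hnorm]
  ring

theorem IsProjectiveRep.memLp_coeff_apply [Group G] [MeasurableMul G] [μ.IsMulLeftInvariant]
    (hπ : IsProjectiveRep π) {f : H} (hf : MemLp (coeff π g f) 2 μ) (x : G) :
    MemLp (coeff π g (π x f)) 2 μ := by
  have h := hf.comp_measurePreserving (measurePreserving_mul_left μ x⁻¹)
  exact (memLp_congr_norm (hπ.stronglyMeasurable_coeff _ _).aestronglyMeasurable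
    h.1 (ae_of_all _ fun y => hπ.norm_coeff_apply g f x y)).2 h

theorem IsProjectiveRep.memLp_coeff_symm_apply [Group G] [MeasurableMul G]
    [μ.IsMulLeftInvariant] (hπ : IsProjectiveRep π) {f : H} (hf : MemLp (coeff π g f) 2 μ)
    (x : G) : MemLp (coeff π g ((π x).symm f)) 2 μ := by
  have h := hf.comp_measurePreserving (measurePreserving_mul_left μ x)
  exact (memLp_congr_norm (hπ.stronglyMeasurable_coeff _ _).aestronglyMeasurable
    h.1 (ae_of_all _ fun y => hπ.norm_coeff_symm_apply g f x y)).2 h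

theorem IsProjectiveRep.coeffResolvent_apply_comm [CompleteSpace H] [Group G] [MeasurableMul G]
    [μ.IsMulLeftInvariant] (hπ : IsProjectiveRep π) (g : H) (x : G) (v : H) :
    coeffResolvent π g μ (π x v) = π x (coeffResolvent π g μ v) := by
  refine coeffResolvent_eq (hπ.memLp_coeff_apply (memLp_coeff_coeffResolvent v) x) fun d hd => ?_
  rw [(π x).inner_map_eq_flip, (π x).inner_map_eq_flip,
    inner_eq_inner_coeffResolvent_add v (hπ.memLp_coeff_symm_apply hd x)]
  simp_rw [hπ.conj_coeff_mul_coeff g _ d x]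
  rw [integral_mul_left_eq_self fun y =>
    conj (coeff π g (coeffResolvent π g μ v) y) * coeff π g ((π x).symm d) y]

theorem IsProjectiveRep.eq_zero_of_coeff_ae_eq_zero [CompleteSpace H] [Group G] [NeZero μ]
    (hπ : IsProjectiveRep π) (h : ∀ f, coeff π g f =ᵐ[μ] 0) : g = 0 := by
  have hae : (fun x => π x g) =ᵐ[μ] 0 := by
    refine ae_eq_zero_of_forall_dual_of_isSeparable ℂ
      (hπ.stronglyMeasurable g).isSeparable_range (fun φ => ?_)
      (ae_of_all _ fun x => Set.mem_range_self x)
    obtain ⟨v, rfl⟩ := (InnerProductSpace.toDual ℂ H).surjective φ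
    filter_upwards [h v] with x hx
    simpa using inner_eq_zero_symm.1 (show inner ℂ (π x g) v = 0 from hx)
  obtain ⟨x, hx⟩ := hae.exists
  simpa using hx

theorem IsProjectiveRep.exists_isAdmissible [CompleteSpace H] [Group G] [MeasurableMul G]
    [μ.IsMulLeftInvariant] [NeZero μ] (hπ : IsProjectiveRep π) (hirr : IsIrreducibleRep π)
    (hg : g ≠ 0) (hgg : MemLp (coeff π g g) 2 μ) : ∃ c, IsAdmissible μ π g c := by
  obtain ⟨t, ht⟩ := hirr.exists_eq_smul (isSelfAdjoint_coeffResolvent (μ := μ) (g := g))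
    (hπ.coeffResolvent_apply_comm g)
  have hspec : ∀ f, MemLp (coeff π g f) 2 μ →
      ‖f‖ ^ 2 = t * (‖f‖ ^ 2 + ∫ y, ‖coeff π g f y‖ ^ 2 ∂μ) := fun f hf => by
    have h := inner_eq_inner_coeffResolvent_add f hf
    simp only [ht, inner_smul_left, coeff_smul, Pi.smul_apply, smul_eq_mul, _root_.map_mul,
      Complex.conj_ofReal, mul_assoc, integral_const_mul, integral_conj_mul_self,
      inner_self_eq_norm_sq_to_K, Complex.coe_algebraMap] at h
    rw [mul_add]
    exact_mod_cast h
  have hg_sq : 0 < ‖g‖ ^ 2 := by positivity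
  have ht0 : t ≠ 0 := by
    rintro rfl
    exact hg_sq.ne' ((hspec g hgg).trans (zero_mul _))
  have hmem : ∀ f, MemLp (coeff π g f) 2 μ := fun f => by
    have h := memLp_coeff_coeffResolvent (π := π) (g := g) (μ := μ) ((t : ℂ)⁻¹ • f)
    rwa [ht, smul_inv_smul₀ (Complex.ofReal_ne_zero.2 ht0)] at h
  have hint : ∀ f, ∫ y, ‖coeff π g f y‖ ^ 2 ∂μ = (t⁻¹ - 1) * ‖f‖ ^ 2 := fun f => by
    linear_combination -t⁻¹ * hspec f (hmem f) -
      (‖f‖ ^ 2 + ∫ y, ‖coeff π g f y‖ ^ 2 ∂μ) * inv_mul_cancel₀ ht0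
  have hnonneg : 0 ≤ t⁻¹ - 1 := nonneg_of_mul_nonneg_left
    ((integral_nonneg fun y => by positivity).trans_eq (hint g)) hg_sq
  refine ⟨t⁻¹ - 1, hnonneg.lt_of_ne fun h0 => hg ?_, hmem, hint⟩
  refine hπ.eq_zero_of_coeff_ae_eq_zero (μ := μ) fun f => ?_
  have hf := hint f
  rw [← h0, zero_mul, integral_eq_zero_iff_of_nonneg (fun y => by positivity)
    (integrable_norm_sq (hmem f))] at hf
  filter_upwards [hf] with y hy
  simpa using hy

end Admissible

section Frames

variable {ι H : Type*} [NormedAddCommGroup H] [InnerProductSpace ℂ H]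

/-- `e` is a Bessel family with bound `B`, i.e. satisfies the upper frame inequality. -/
def IsBessel (e : ι → H) (B : ℝ) : Prop :=
  ∀ f : H, Summable (fun i => ‖inner ℂ (e i) f‖ ^ 2) ∧
    ∑' i, ‖inner ℂ (e i) f‖ ^ 2 ≤ B * ‖f‖ ^ 2

variable {e : ι → H} {A B : ℝ}

theorem IsBessel.norm_inner_sq_le (h : IsBessel e B) (i : ι) (f : H) :
    ‖inner ℂ (e i) f‖ ^ 2 ≤ B * ‖f‖ ^ 2 :=
  ((h f).1.le_tsum i fun _ _ => by positivity).trans (h f).2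

theorem IsBessel.mono (h : IsBessel e A) (hAB : A ≤ B) : IsBessel e B := fun f =>
  ⟨(h f).1, (h f).2.trans (by gcongr)⟩

theorem IsBessel.comp_injective {κ : Type*} (h : IsBessel e B) {φ : κ → ι}
    (hφ : Function.Injective φ) : IsBessel (fun k => e (φ k)) B := fun f =>
  ⟨(h f).1.comp_injective hφ,
    (tsum_comp_le_tsum_of_inj (h f).1 (fun _ => by positivity) hφ).trans (h f).2⟩

theorem IsBessel.nonneg (h : IsBessel e B) {f : H} (hf : f ≠ 0) : 0 ≤ B :=
  nonneg_of_mul_nonneg_left ((tsum_nonneg fun _ => by positivity).trans (h f).2)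
    (by positivity : 0 < ‖f‖ ^ 2)

theorem IsBessel.norm_le_sqrt (h : IsBessel e B) (i : ι) : ‖e i‖ ≤ √B := by
  rcases eq_or_ne (e i) 0 with h0 | h0
  · simp [h0]
  refine Real.le_sqrt_of_sq_le (le_of_mul_le_mul_right ?_ (by positivity : 0 < ‖e i‖ ^ 2))
  have hi := h.norm_inner_sq_le i (e i)
  rwa [inner_self_eq_norm_sq_to_K, norm_pow, RCLike.norm_ofReal, abs_norm, sq (‖e i‖ ^ 2)] at hi

theorem IsBessel.sqrt_tsum_le (h : IsBessel e B) (f : H) :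
    √(∑' i, ‖inner ℂ (e i) f‖ ^ 2) ≤ √B * ‖f‖ := by
  rw [← Real.sqrt_sq (norm_nonneg f), ← Real.sqrt_mul' _ (by positivity)]
  exact Real.sqrt_le_sqrt (h f).2

theorem IsBessel.countable (h : IsBessel e B)
    (hsep : TopologicalSpace.IsSeparable (Set.range e)) (h0 : ∀ i, e i ≠ 0) : Countable ι := by
  obtain ⟨t, -, ht, hdense⟩ := hsep.exists_countable_dense_subset
  have hcover : (⋃ v ∈ t, Function.support fun i => ‖inner ℂ (e i) v‖ ^ 2) = Set.univ := by
    refine Set.eq_univ_of_forall fun i => ?_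
    by_contra hi
    have horth : t ⊆ {v | inner ℂ (e i) v = 0} := fun v hv => by
      by_contra hne
      exact hi (Set.mem_biUnion hv (by simpa using hne))
    have hclosed : IsClosed {v | inner ℂ (e i) v = 0} :=
      isClosed_eq (continuous_const.inner continuous_id) continuous_const
    exact h0 i (inner_self_eq_zero.1
      (hclosed.closure_subset_iff.2 horth (hdense (Set.mem_range_self i))))
  exact Set.countable_univ_iff.1 (hcover ▸ ht.biUnion fun v _ => (h v).1.countable_support)

theorem IsBessel.map_of_isSelfAdjoint [CompleteSpace H] (h : IsBessel e B) {R : H →L[ℂ] H}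
    (hR : IsSelfAdjoint R) : IsBessel (fun i => R (e i)) (B * ‖R‖ ^ 2) := fun u => by
  rcases eq_or_ne u 0 with rfl | hu
  · simp
  have hB := h.nonneg hu
  have hsymm : ∀ i, inner ℂ (R (e i)) u = inner ℂ (e i) (R u) := fun i =>
    ContinuousLinearMap.isSelfAdjoint_iff_isSymmetric.1 hR _ _
  simp only [hsymm]
  refine ⟨(h (R u)).1, (h (R u)).2.trans ?_⟩
  rw [mul_assoc, ← mul_pow]
  gcongr
  exact R.le_opNorm u

/-- The analysis operator `f ↦ (⟨f, e i⟩)_i` of a Bessel family, with values in `ℓ²`. -/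
noncomputable def IsBessel.analysis (h : IsBessel e B) : H →ₗ[ℂ] lp (fun _ : ι => ℂ) 2 where
  toFun f := ⟨fun i => inner ℂ (e i) f, (memℓp_gen_iff (by norm_num)).2 (by simpa using (h f).1)⟩
  map_add' u v := by ext i; exact inner_add_right _ _ _
  map_smul' s u := by ext i; exact inner_smul_right _ _ _

theorem IsBessel.norm_analysis_sq (h : IsBessel e B) (f : H) :
    ‖h.analysis f‖ ^ 2 = ∑' i, ‖inner ℂ (e i) f‖ ^ 2 := by
  have h2 := lp.norm_rpow_eq_tsum (p := 2) (by norm_num) (h.analysis f)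
  simpa [IsBessel.analysis] using h2

theorem re_inner_mem_Icc_of_hasSum {R : H →L[ℂ] H}
    (hrec : ∀ f, HasSum (fun i => inner ℂ (e i) (R f) • e i) f) (i : ι) :
    (inner ℂ (R (e i)) (e i)).re ∈ Set.Icc (0 : ℝ) 1 := by
  have hsum : HasSum (fun j => ‖inner ℂ (e j) (R (e i))‖ ^ 2) (inner ℂ (R (e i)) (e i)).re := by
    refine (Complex.hasSum_re ((hrec (e i)).mapL (innerSL ℂ (R (e i))))).congr_fun fun j => ?_
    rw [innerSL_apply_apply, inner_smul_right, ← inner_conj_symm (R (e i)),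
      Complex.mul_conj', ← Complex.ofReal_pow, Complex.ofReal_re]
  set s := (inner ℂ (R (e i)) (e i)).re
  have hsq : s ^ 2 ≤ s := calc
    s ^ 2 ≤ ‖inner ℂ (R (e i)) (e i)‖ ^ 2 := sq_le_sq.2 (by
      simpa using Complex.abs_re_le_norm (inner ℂ (R (e i)) (e i)))
    _ = ‖inner ℂ (e i) (R (e i))‖ ^ 2 := by rw [norm_inner_symm]
    _ ≤ s := le_hasSum hsum i fun _ _ => by positivity
  exact ⟨hsum.nonneg fun _ => by positivity, by nlinarith⟩

variable [CompleteSpace H]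

theorem IsBessel.exists_frameOperator (h : IsBessel e B) :
    ∃ S : H →L[ℂ] H, IsSelfAdjoint S ∧
      (∀ f, HasSum (fun i => inner ℂ (e i) f • e i) (S f)) ∧
      ∀ f, inner ℂ (S f) f = ((∑' i, ‖inner ℂ (e i) f‖ ^ 2 : ℝ) : ℂ) := by
  classical
  let C : H →L[ℂ] lp (fun _ : ι => ℂ) 2 := h.analysis.mkContinuous √B fun f => by
    rcases eq_or_ne f 0 with rfl | hf
    · simp
    refine le_of_sq_le_sq ?_ (by positivity)
    rw [h.norm_analysis_sq, mul_pow, Real.sq_sqrt (h.nonneg hf)]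
    exact (h f).2
  have hC : ∀ f i, C f i = inner ℂ (e i) f := fun _ _ => rfl
  refine ⟨C.adjoint ∘L C, ?_, fun f => ?_, fun f => ?_⟩
  · rw [ContinuousLinearMap.isSelfAdjoint_iff', ContinuousLinearMap.adjoint_comp,
      ContinuousLinearMap.adjoint_adjoint]
  · refine (C.adjoint.hasSum (lp.hasSum_single (by norm_num) (C f))).congr_fun fun i => ?_
    refine ext_inner_right ℂ fun v => ?_
    rw [ContinuousLinearMap.adjoint_inner_left, lp.inner_single_left, hC, hC, inner_smul_left,
      RCLike.inner_apply, mul_comm]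
  · rw [ContinuousLinearMap.comp_apply, ContinuousLinearMap.adjoint_inner_left,
      ← h.norm_analysis_sq, inner_self_eq_norm_sq_to_K]
    push_cast
    rfl

theorem IsBessel.exists_inverse_frameOperator (h : IsBessel e B) (hA : 0 < A)
    (hlower : ∀ f, A * ‖f‖ ^ 2 ≤ ∑' i, ‖inner ℂ (e i) f‖ ^ 2) :
    ∃ R : H →L[ℂ] H, IsSelfAdjoint R ∧
      (∀ f, HasSum (fun i => inner ℂ (e i) (R f) • e i) f) ∧
      ∀ f, R (∑' i, inner ℂ (e i) f • e i) = f := by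
  obtain ⟨S, hS, hsum, hquad⟩ := h.exists_frameOperator
  have hunit : IsUnit S := by
    refine S.isUnit_of_forall_le_norm_inner_map (c := ⟨A, hA.le⟩) hA fun f => ?_
    rw [hquad, Complex.norm_real, Real.norm_eq_abs, mul_comm]
    exact (hlower f).trans (le_abs_self _)
  obtain ⟨u, rfl⟩ := hunit
  have hright : ∀ f, (u : H →L[ℂ] H) ((↑u⁻¹ : H →L[ℂ] H) f) = f := DFunLike.congr_fun u.mul_inv
  have hleft : ∀ f, (↑u⁻¹ : H →L[ℂ] H) ((u : H →L[ℂ] H) f) = f := DFunLike.congr_fun u.inv_mul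
  refine ⟨↑u⁻¹, ContinuousLinearMap.isSelfAdjoint_iff_isSymmetric.2 fun v w => ?_, fun f => ?_,
    fun f => ?_⟩
  · have hsymm := ContinuousLinearMap.isSelfAdjoint_iff_isSymmetric.1 hS
    have hvw := hsymm ((↑u⁻¹ : H →L[ℂ] H) v) ((↑u⁻¹ : H →L[ℂ] H) w)
    simp only [ContinuousLinearMap.coe_coe, hright] at hvw
    exact hvw.symm
  · simpa only [hright] using hsum ((↑u⁻¹ : H →L[ℂ] H) f)
  · rw [(hsum f).tsum_eq, hleft]

end Frames

section CanonicalDual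

variable {G H : Type*} [NormedAddCommGroup H] [InnerProductSpace ℂ H] {π : G → H ≃ₗᵢ[ℂ] H}
  {g : H} {Λ : Set G}

theorem canonicalDual_eq {R : H →L[ℂ] H}
    (hrec : ∀ f, HasSum (fun l : Λ => inner ℂ (π l g) (R f) • π l g) f)
    (hleft : ∀ f, R (∑' l : Λ, inner ℂ (π l g) f • π l g) = f) (l : G) :
    canonicalDual π g Λ l = R (π l g) := by
  have hright : frameOperator π g Λ (R (π l g)) = π l g := (hrec (π l g)).tsum_eq
  calc canonicalDual π g Λ l
      = R (frameOperator π g Λ (canonicalDual π g Λ l)) := (hleft _).symm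
    _ = R (π l g) := by rw [canonicalDual, Function.invFun_eq ⟨_, hright⟩]

/-- The family `(d l)_{l ∈ Λ}` is a dual frame of `π(Λ) g`, with a common Bessel bound `B`, whose
diagonal coefficients `⟨π l g, d l⟩` lie in `[0, 1]` as those of the canonical dual frame do. -/
structure IsDualFrame (π : G → H ≃ₗᵢ[ℂ] H) (g : H) (Λ : Set G) (d : G → H) (B : ℝ) : Prop where
  bessel : IsBessel (fun l : Λ => π l g) B
  bessel_dual : IsBessel (fun l : Λ => d l) B
  hasSum : ∀ f, HasSum (fun l : Λ => inner ℂ (d l) f • π l g) f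
  re_inner_mem_Icc : ∀ l ∈ Λ, (inner ℂ (d l) (π l g)).re ∈ Set.Icc (0 : ℝ) 1

theorem IsCoherentFrame.exists_isDualFrame [CompleteSpace H] (hframe : IsCoherentFrame π g Λ) :
    ∃ B, IsDualFrame π g Λ (canonicalDual π g Λ) B := by
  obtain ⟨A, B, hA, -, h⟩ := hframe
  have hbessel : IsBessel (fun l : Λ => π l g) B := fun f => ⟨(h f).1, (h f).2.2⟩
  obtain ⟨R, hR, hrec, hleft⟩ := hbessel.exists_inverse_frameOperator hA fun f => (h f).2.1
  have hsymm : ∀ u v, inner ℂ (R u) v = inner ℂ u (R v) :=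
    ContinuousLinearMap.isSelfAdjoint_iff_isSymmetric.1 hR
  have hdual := canonicalDual_eq hrec hleft
  refine ⟨max B (B * ‖R‖ ^ 2), hbessel.mono (le_max_left _ _), ?_, fun f => ?_, fun l hl => ?_⟩
  · simpa only [hdual] using (hbessel.map_of_isSelfAdjoint hR).mono (le_max_right _ _)
  · simpa only [hdual, hsymm] using hrec f
  · simpa only [hdual] using re_inner_mem_Icc_of_hasSum hrec ⟨l, hl⟩

end CanonicalDual

section Counting

variable {G : Type*} {Λ : Set G}

theorem tsum_indicator_one_eq_encard (Λ A : Set G) :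
    ∑' l : Λ, A.indicator (1 : G → ℝ≥0∞) l = ((Λ ∩ A).encard : ℝ≥0∞) := by
  classical
  rw [tsum_subtype Λ (A.indicator (1 : G → ℝ≥0∞)), Set.indicator_indicator,
    ← tsum_subtype (Λ ∩ A) (1 : G → ℝ≥0∞)]
  exact ENNReal.tsum_set_one _

variable [Group G]

/-- The points of `E` that are reached from the complement of `E` by right translation by an
element of `L`. -/
def innerBoundary (E L : Set G) : Set G :=
  E ∩ (Eᶜ * L)

theorem smul_innerBoundary (x : G) (E L : Set G) :
    innerBoundary (x • E) L = x • innerBoundary E L := by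
  rw [innerBoundary, innerBoundary, ← Set.smul_set_compl, smul_mul_assoc, Set.smul_set_inter]

theorem measurableSet_innerBoundary [TopologicalSpace G] [MeasurableSpace G] [IsTopologicalGroup G]
    [BorelSpace G] {E : Set G} (hE : IsClosed E) (L : Set G) : MeasurableSet (innerBoundary E L) :=
  hE.measurableSet.inter hE.isOpen_compl.mul_right.measurableSet

/-- Every compact set has a uniform bound for the number of points of `Λ` in its left
translates. -/
def IsRelativelySeparated [TopologicalSpace G] (Λ : Set G) : Prop :=
  ∀ K : Set G, IsCompact K → ∃ N : ℕ, ∀ x : G, (Λ ∩ x • K).encard ≤ N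

theorem tsum_indicator_inv_mul (Λ K : Set G) (y : G) :
    ∑' l : Λ, K.indicator (1 : G → ℝ≥0∞) (y⁻¹ * l) = ((Λ ∩ y • K).encard : ℝ≥0∞) := by
  classical
  rw [← tsum_indicator_one_eq_encard]
  simp only [Set.indicator_apply, Set.mem_smul_set_iff_inv_smul_mem, smul_eq_mul, Pi.one_apply]

variable [MeasurableSpace G] [MeasurableMul G] {μ : Measure G} [μ.IsMulLeftInvariant]

theorem lintegral_tsum_inv_mul (hΛ : Λ.Countable) {f : G → ℝ≥0∞} (hf : Measurable f) :
    ∫⁻ y, ∑' l : Λ, f ((l : G)⁻¹ * y) ∂μ = Λ.encard * ∫⁻ y, f y ∂μ := by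
  have := hΛ.to_subtype
  have hmeas (l : Λ) : Measurable fun y => f ((l : G)⁻¹ * y) := hf.comp (measurable_const_mul _)
  rw [lintegral_tsum fun l => (hmeas l).aemeasurable]
  simp only [lintegral_mul_left_eq_self f]
  rw [ENNReal.tsum_const, ENat.card_coe_set_eq]

theorem encard_inter_mul_setLIntegral_le (hΛ : Λ.Countable) (E : Set G) {W : Set G}
    (hW : MeasurableSet W) {f : G → ℝ≥0∞} (hf : Measurable f) {S : ℝ≥0∞}
    (hS : ∀ y, ∑' l : Λ, f ((l : G)⁻¹ * y) ≤ S) :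
    ((Λ ∩ E).encard : ℝ≥0∞) * ∫⁻ y in W, f y ∂μ ≤ S * μ (E * W) := by
  rw [← lintegral_indicator hW,
    ← lintegral_tsum_inv_mul (hΛ.mono Set.inter_subset_left) (hf.indicator hW)]
  refine le_trans (lintegral_mono fun y => ?_) (lintegral_indicator_const_le _ _)
  by_cases hy : y ∈ E * W
  · rw [Set.indicator_of_mem hy]
    calc ∑' l : ↥(Λ ∩ E), W.indicator f ((l : G)⁻¹ * y)
        ≤ ∑' l : ↥(Λ ∩ E), f ((l : G)⁻¹ * y) :=
          ENNReal.tsum_le_tsum fun _ => Set.indicator_le_self _ _ _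
      _ ≤ ∑' l : Λ, f ((l : G)⁻¹ * y) :=
          ENNReal.tsum_mono_subtype (fun l => f (l⁻¹ * y)) Set.inter_subset_left
      _ ≤ S := hS y
  · refine (ENNReal.tsum_eq_zero.2 fun l => Set.indicator_of_notMem (fun hl => hy ?_) _).trans_le
      zero_le
    exact ⟨l, l.2.2, _, hl, mul_inv_cancel_left _ _⟩

section

variable [MeasurableInv G] [μ.IsInvInvariant] {K : Set G} {S : ℝ≥0∞}

theorem lintegral_encard_inter_smul (hΛ : Λ.Countable) (hK : MeasurableSet K) :
    ∫⁻ y, ((Λ ∩ y • K).encard : ℝ≥0∞) ∂μ = Λ.encard * μ K := by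
  have hf : Measurable fun y : G => K.indicator (1 : G → ℝ≥0∞) y⁻¹ :=
    (measurable_one.indicator hK).comp measurable_inv
  calc ∫⁻ y, ((Λ ∩ y • K).encard : ℝ≥0∞) ∂μ
      = ∫⁻ y, ∑' l : Λ, K.indicator (1 : G → ℝ≥0∞) ((l : G)⁻¹ * y)⁻¹ ∂μ := by
        simp only [mul_inv_rev, inv_inv, tsum_indicator_inv_mul]
    _ = Λ.encard * μ K := by
        rw [lintegral_tsum_inv_mul hΛ hf, lintegral_inv_eq_self, lintegral_indicator_one hK]

theorem encard_inter_mul_measure_le (hΛ : Λ.Countable) (E : Set G) (hK : MeasurableSet K)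
    (hS : ∀ y : G, ((Λ ∩ y • K).encard : ℝ≥0∞) ≤ S) :
    ((Λ ∩ E).encard : ℝ≥0∞) * μ K ≤ S * μ (E * K⁻¹) := by
  have hcount := encard_inter_mul_setLIntegral_le (μ := μ) (S := S) hΛ E hK.inv
    (f := fun y => K.indicator 1 y⁻¹) ((measurable_one.indicator hK).comp measurable_inv)
    fun y => by simpa only [mul_inv_rev, inv_inv, tsum_indicator_inv_mul] using hS y
  rwa [setLIntegral_congr_fun (g := fun _ => 1) hK.inv fun y hy =>
    Set.indicator_of_mem (Set.mem_inv.1 hy) 1, setLIntegral_one, μ.measure_inv] at hcount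

theorem mul_measure_le_encard_inter (hΛ : Λ.Countable) {E : Set G}
    (hE : MeasurableSet (E \ innerBoundary E K⁻¹)) (hK : MeasurableSet K)
    (hS : ∀ y : G, S ≤ ((Λ ∩ y • K).encard : ℝ≥0∞)) :
    S * μ (E \ innerBoundary E K⁻¹) ≤ ((Λ ∩ E).encard : ℝ≥0∞) * μ K := by
  rw [← lintegral_encard_inter_smul (hΛ.mono Set.inter_subset_left) hK,
    ← lintegral_indicator_const hE]
  refine lintegral_mono fun y => Set.indicator_apply_le' (fun hy => ?_) fun _ => zero_le
  have hsub : y • K ⊆ E := by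
    rintro _ ⟨k, hk, rfl⟩
    by_contra hkE
    exact hy.2 ⟨hy.1, _, hkE, k⁻¹, Set.inv_mem_inv.2 hk, by simp⟩
  rw [Set.inter_assoc, Set.inter_eq_right.2 hsub]
  exact hS y

end

end Counting

theorem isInvInvariant_of_isMulRightInvariant {G : Type*} [Group G] [TopologicalSpace G]
    [IsTopologicalGroup G] [LocallyCompactSpace G] [SecondCountableTopology G]
    [MeasurableSpace G] [BorelSpace G] (μ : Measure G) [μ.IsHaarMeasure] [μ.IsMulRightInvariant] :
    μ.IsInvInvariant := by
  let c : ℝ≥0∞ := Measure.haarScalarFactor μ.inv μ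
  have hinv : μ.inv = c • μ := Measure.isMulLeftInvariant_eq_smul μ.inv μ
  have hμ : c ^ 2 • μ = μ := by
    conv_rhs => rw [← Measure.inv_inv μ, hinv, Measure.inv_def, Measure.map_smul,
      ← Measure.inv_def, hinv, smul_smul, ← pow_two]
  obtain ⟨K⟩ : Nonempty (TopologicalSpace.PositiveCompacts G) := inferInstance
  have hK : c ^ 2 * μ K = 1 ^ 2 * μ K := by
    rw [one_pow, one_mul, ← smul_eq_mul, ← Measure.smul_apply, hμ]
  have hc : c ^ 2 = 1 ^ 2 := (ENNReal.mul_left_inj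
    (Measure.measure_pos_of_nonempty_interior _ K.interior_nonempty).ne'
    K.isCompact.measure_lt_top.ne).1 hK
  exact ⟨by rw [hinv, (ENNReal.pow_right_strictMono two_ne_zero).injective hc, one_smul]⟩

section Folner

variable {G : Type*} [Group G] [TopologicalSpace G] [MeasurableSpace G] {μ : Measure G}
  {K : ℕ → Set G}

theorem IsStrongFolner.nonempty (hK : IsStrongFolner μ K) (n : ℕ) : (K n).Nonempty :=
  nonempty_of_measure_ne_zero (hK.nonnull n).ne'

variable [IsFiniteMeasureOnCompacts μ]

theorem IsStrongFolner.measureReal_pos (hK : IsStrongFolner μ K) (n : ℕ) : 0 < μ.real (K n) :=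
  ENNReal.toReal_pos (hK.nonnull n).ne' (hK.isCompact n).measure_lt_top.ne

theorem IsStrongFolner.eventually_measureReal_le (hK : IsStrongFolner μ K) {s : ℕ → Set G}
    (hs : Tendsto (fun n => μ (s n) / μ (K n)) atTop (𝓝 0)) {δ : ℝ} (hδ : 0 < δ) :
    ∀ᶠ n in atTop, μ.real (s n) ≤ δ * μ.real (K n) := by
  filter_upwards [ENNReal.tendsto_nhds_zero.1 hs (ENNReal.ofReal δ) (ENNReal.ofReal_pos.2 hδ)]
    with n hn
  have hfin : μ (K n) ≠ ∞ := (hK.isCompact n).measure_lt_top.ne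
  rw [ENNReal.div_le_iff (hK.nonnull n).ne' hfin] at hn
  simpa [measureReal_def, hδ.le] using
    ENNReal.toReal_mono (ENNReal.mul_ne_top ENNReal.ofReal_ne_top hfin) hn

variable [IsTopologicalGroup G]

theorem IsStrongFolner.eventually_measureReal_mul_le (hK : IsStrongFolner μ K) {L : Set G}
    (hL : IsCompact L) (hne : L.Nonempty) {δ : ℝ} (hδ : 0 < δ) :
    ∀ᶠ n in atTop, μ.real (K n * L) ≤ (1 + δ) * μ.real (K n) := by
  filter_upwards [hK.eventually_measureReal_le (hK.folner L hL hne) hδ] with n hn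
  have hcover : K n * L ⊆ (K n * L) ∆ K n ∪ K n := le_symmDiff_sup_right _ _
  have hcompact : IsCompact (K n * L ∪ K n) := ((hK.isCompact n).mul hL).union (hK.isCompact n)
  have hfin : μ ((K n * L) ∆ K n ∪ K n) ≠ ∞ := (hcompact.measure_lt_top.trans_le' <|
    measure_mono (Set.union_subset symmDiff_le_sup Set.subset_union_right)).ne
  linarith [measureReal_mono (μ := μ) hcover hfin,
    measureReal_union_le (μ := μ) ((K n * L) ∆ K n) (K n)]

theorem IsStrongFolner.eventually_measureReal_innerBoundary_mul_le (hK : IsStrongFolner μ K)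
    {L V : Set G} (hL : IsCompact L) (hV : IsCompact V) (hne : V.Nonempty) {δ : ℝ}
    (hδ : 0 < δ) :
    ∀ᶠ n in atTop, μ.real (innerBoundary (K n) L * V) ≤ δ * μ.real (K n) := by
  have hW : IsCompact (V ∪ L * V) := hV.union (hL.mul hV)
  filter_upwards [hK.eventually_measureReal_le (hK.strong _ hW hne.inl) hδ] with n hn
  refine (measureReal_mono ?_ ?_).trans hn
  · refine Set.subset_inter
      (Set.mul_subset_mul Set.inter_subset_left Set.subset_union_left) ?_
    refine (Set.mul_subset_mul_right Set.inter_subset_right).trans ?_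
    rw [mul_assoc]
    exact Set.mul_subset_mul_left Set.subset_union_right
  · exact (((hK.isCompact n).mul hW).measure_lt_top.trans_le'
      (measure_mono Set.inter_subset_left)).ne

theorem IsStrongFolner.eventually_measureReal_innerBoundary_le (hK : IsStrongFolner μ K)
    {L : Set G} (hL : IsCompact L) {δ : ℝ} (hδ : 0 < δ) :
    ∀ᶠ n in atTop, μ.real (innerBoundary (K n) L) ≤ δ * μ.real (K n) := by
  simpa using hK.eventually_measureReal_innerBoundary_mul_le hL isCompact_singleton
    (Set.singleton_nonempty 1) hδ

end Folner

section Density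

theorem encard_eq_ofReal_ncard {α : Type*} {s : Set α} (hs : s.Finite) :
    (s.encard : ℝ≥0∞) = ENNReal.ofReal (s.ncard : ℝ) := by
  rw [← hs.cast_ncard_eq, ENNReal.ofReal_natCast, ENat.toENNReal_coe]

theorem tendsto_iInf_of_eventually_le {ι : Type*} {f : ι → ℝ} (hf : BddBelow (Set.range f))
    {u : ℕ → ι} (hu : ∀ i, ∀ ε > 0, ∀ᶠ n in atTop, f (u n) ≤ f i + ε) :
    Tendsto (fun n => f (u n)) atTop (𝓝 (⨅ i, f i)) := by
  have : Nonempty ι := ⟨u 0⟩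
  refine tendsto_order.2 ⟨fun a ha => .of_forall fun n => ha.trans_le (ciInf_le hf _),
    fun a ha => ?_⟩
  obtain ⟨i, hi⟩ := exists_lt_of_ciInf_lt ha
  filter_upwards [hu i ((a - f i) / 2) (by linarith)] with n hn
  linarith

theorem tendsto_iSup_of_eventually_le {ι : Type*} {f : ι → ℝ} (hf : BddAbove (Set.range f))
    {u : ℕ → ι} (hu : ∀ i, ∀ ε > 0, ∀ᶠ n in atTop, f i ≤ f (u n) + ε) :
    Tendsto (fun n => f (u n)) atTop (𝓝 (⨆ i, f i)) := by
  have : Nonempty ι := ⟨u 0⟩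
  refine tendsto_order.2 ⟨fun a ha => ?_,
    fun a ha => .of_forall fun n => (le_ciSup hf _).trans_lt ha⟩
  obtain ⟨i, hi⟩ := exists_lt_of_lt_ciSup ha
  filter_upwards [hu i ((f i - a) / 2) (by linarith)] with n hn
  linarith

section

variable {G : Type*} [Group G] [MeasurableSpace G]

/-- The number of points of `Λ` in `x • K` per unit of Haar measure. -/
noncomputable def pointDensity (μ : Measure G) (Λ K : Set G) (x : G) : ℝ :=
  (Λ ∩ x • K).ncard / μ.real K

/-- The upper Beurling density, as an infimum over all compact sets of positive measure. -/
noncomputable def upperDensity [TopologicalSpace G] (μ : Measure G) (Λ : Set G) : ℝ :=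
  ⨅ K : {K : Set G // IsCompact K ∧ 0 < μ.real K}, ⨆ x, pointDensity μ Λ K x

/-- The lower Beurling density, as a supremum over all compact sets of positive measure. -/
noncomputable def lowerDensity [TopologicalSpace G] (μ : Measure G) (Λ : Set G) : ℝ :=
  ⨆ K : {K : Set G // IsCompact K ∧ 0 < μ.real K}, ⨅ x, pointDensity μ Λ K x

variable {μ : Measure G} {Λ : Set G}

theorem pointDensity_nonneg (K : Set G) (x : G) : 0 ≤ pointDensity μ Λ K x := by
  unfold pointDensity; positivity

theorem bddBelow_pointDensity (K : Set G) : BddBelow (Set.range (pointDensity μ Λ K)) :=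
  ⟨0, Set.forall_mem_range.2 (pointDensity_nonneg K)⟩

end

variable {G : Type*} [Group G] [TopologicalSpace G] {Λ K : Set G}

theorem IsRelativelySeparated.finite (hΛ : IsRelativelySeparated Λ) (hK : IsCompact K) :
    (Λ ∩ K).Finite := by
  obtain ⟨N, hN⟩ := hΛ K hK
  have hN1 := hN 1
  rw [one_smul] at hN1
  exact Set.finite_of_encard_le_coe hN1

variable [IsTopologicalGroup G] [MeasurableSpace G] {μ : Measure G}

theorem IsRelativelySeparated.bddAbove_pointDensity (hΛ : IsRelativelySeparated Λ)
    (hK : IsCompact K) : BddAbove (Set.range (pointDensity μ Λ K)) := by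
  obtain ⟨N, hN⟩ := hΛ K hK
  refine ⟨N / μ.real K, Set.forall_mem_range.2 fun x => ?_⟩
  have hx := hN x
  rw [← (hΛ.finite (hK.smul x)).cast_ncard_eq, Nat.cast_le] at hx
  unfold pointDensity
  gcongr

variable [T2Space G] [BorelSpace G] [IsFiniteMeasureOnCompacts μ] [μ.IsMulLeftInvariant]
  [μ.IsInvInvariant] {E : Set G} {S : ℝ}

theorem IsRelativelySeparated.ncard_inter_mul_measureReal_le (hΛ : IsRelativelySeparated Λ)
    (hΛc : Λ.Countable) {D : Set G} (hDE : D ⊆ E) (hE : IsCompact E) (hK : IsCompact K)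
    (hS : ∀ y : G, ((Λ ∩ y • K).ncard : ℝ) ≤ S) :
    ((Λ ∩ D).ncard : ℝ) * μ.real K ≤ S * μ.real (D * K⁻¹) := by
  have hS0 : 0 ≤ S := (Nat.cast_nonneg _).trans (hS 1)
  have hcount := encard_inter_mul_measure_le (μ := μ) hΛc D hK.measurableSet
    (S := ENNReal.ofReal S) fun y => by
      rw [encard_eq_ofReal_ncard (hΛ.finite (hK.smul y))]
      exact ENNReal.ofReal_le_ofReal (hS y)
  have hfin : μ (D * K⁻¹) ≠ ∞ := ((hE.mul hK.inv).measure_lt_top.trans_le'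
    (measure_mono (Set.mul_subset_mul_right hDE))).ne
  rw [encard_eq_ofReal_ncard ((hΛ.finite hE).subset (Set.inter_subset_inter_right _ hDE))]
    at hcount
  simpa [measureReal_def, hS0] using
    ENNReal.toReal_mono (ENNReal.mul_ne_top ENNReal.ofReal_ne_top hfin) hcount

theorem IsRelativelySeparated.mul_measureReal_le_ncard_inter (hΛ : IsRelativelySeparated Λ)
    (hΛc : Λ.Countable) (hE : IsCompact E) (hK : IsCompact K) (hS0 : 0 ≤ S)
    (hS : ∀ y : G, S ≤ (Λ ∩ y • K).ncard) :
    S * μ.real (E \ innerBoundary E K⁻¹) ≤ (Λ ∩ E).ncard * μ.real K := by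
  have hcount := mul_measure_le_encard_inter (μ := μ) hΛc
    (hE.measurableSet.diff (measurableSet_innerBoundary hE.isClosed _)) hK.measurableSet
    (S := ENNReal.ofReal S) fun y => by
      rw [encard_eq_ofReal_ncard (hΛ.finite (hK.smul y))]
      exact ENNReal.ofReal_le_ofReal (hS y)
  rw [encard_eq_ofReal_ncard (hΛ.finite hE)] at hcount
  simpa [measureReal_def, hS0] using ENNReal.toReal_mono
    (ENNReal.mul_ne_top ENNReal.ofReal_ne_top hK.measure_lt_top.ne) hcount

variable {Kn : ℕ → Set G} {ε : ℝ}

theorem IsRelativelySeparated.eventually_iSup_pointDensity_le (hΛ : IsRelativelySeparated Λ)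
    (hΛc : Λ.Countable) (hKn : IsStrongFolner μ Kn) (hK : IsCompact K) (hK0 : 0 < μ.real K)
    (hε : 0 < ε) :
    ∀ᶠ n in atTop, ⨆ x, pointDensity μ Λ (Kn n) x ≤ (⨆ x, pointDensity μ Λ K x) + ε := by
  set S := ⨆ x, pointDensity μ Λ K x
  have hS0 : 0 ≤ S := Real.iSup_nonneg fun x => pointDensity_nonneg K x
  have hS (y : G) : ((Λ ∩ y • K).ncard : ℝ) ≤ S * μ.real K :=
    (div_le_iff₀ hK0).1 (le_ciSup (hΛ.bddAbove_pointDensity hK) y)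
  have hne : K.Nonempty := by
    rw [Set.nonempty_iff_ne_empty]
    rintro rfl
    simp at hK0
  obtain ⟨δ, hδ, hSδ⟩ := exists_pos_mul_lt hε S
  filter_upwards [hKn.eventually_measureReal_mul_le hK.inv hne.inv hδ] with n hn
  refine ciSup_le fun x => (div_le_iff₀ (hKn.measureReal_pos n)).2 ?_
  have hcount := hΛ.ncard_inter_mul_measureReal_le (μ := μ) hΛc subset_rfl
    ((hKn.isCompact n).smul x) hK hS
  rw [smul_mul_assoc, measureReal_def μ (x • _), measure_smul, ← measureReal_def,
    mul_right_comm] at hcount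
  calc ((Λ ∩ x • Kn n).ncard : ℝ) ≤ S * μ.real (Kn n * K⁻¹) := le_of_mul_le_mul_right hcount hK0
    _ ≤ S * ((1 + δ) * μ.real (Kn n)) := by gcongr
    _ = (S + S * δ) * μ.real (Kn n) := by ring
    _ ≤ (S + ε) * μ.real (Kn n) := by gcongr

theorem IsRelativelySeparated.eventually_iInf_pointDensity_le (hΛ : IsRelativelySeparated Λ)
    (hΛc : Λ.Countable) (hKn : IsStrongFolner μ Kn) (hK : IsCompact K) (hK0 : 0 < μ.real K)
    (hε : 0 < ε) :
    ∀ᶠ n in atTop, ⨅ x, pointDensity μ Λ K x ≤ (⨅ x, pointDensity μ Λ (Kn n) x) + ε := by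
  set S := ⨅ x, pointDensity μ Λ K x
  have hS0 : 0 ≤ S := Real.iInf_nonneg fun x => pointDensity_nonneg K x
  have hS (y : G) : S * μ.real K ≤ (Λ ∩ y • K).ncard :=
    (le_div_iff₀ hK0).1 (ciInf_le (bddBelow_pointDensity K) y)
  obtain ⟨δ, hδ, hSδ⟩ := exists_pos_mul_lt hε S
  filter_upwards [hKn.eventually_measureReal_innerBoundary_le hK.inv hδ] with n hn
  rw [← sub_le_iff_le_add]
  refine le_ciInf fun x => (le_div_iff₀ (hKn.measureReal_pos n)).2 ?_
  have hcount := hΛ.mul_measureReal_le_ncard_inter (μ := μ) hΛc ((hKn.isCompact n).smul x) hK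
    (by positivity) hS
  rw [smul_innerBoundary, ← Set.smul_set_sdiff, measureReal_def μ (x • _), measure_smul,
    ← measureReal_def, mul_right_comm] at hcount
  have hsplit : μ.real (Kn n) - μ.real (innerBoundary (Kn n) K⁻¹) ≤
      μ.real (Kn n \ innerBoundary (Kn n) K⁻¹) :=
    le_measureReal_sdiff ((hKn.isCompact n).measure_lt_top.trans_le'
      (measure_mono Set.inter_subset_left)).ne
  calc (S - ε) * μ.real (Kn n) ≤ (S - S * δ) * μ.real (Kn n) := by gcongr
    _ = S * (μ.real (Kn n) - δ * μ.real (Kn n)) := by ring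
    _ ≤ S * μ.real (Kn n \ innerBoundary (Kn n) K⁻¹) := by gcongr; linarith
    _ ≤ (Λ ∩ x • Kn n).ncard := le_of_mul_le_mul_right hcount hK0

theorem IsRelativelySeparated.tendsto_iSup_pointDensity (hΛ : IsRelativelySeparated Λ)
    (hΛc : Λ.Countable) (hKn : IsStrongFolner μ Kn) :
    Tendsto (fun n => ⨆ x, pointDensity μ Λ (Kn n) x) atTop (𝓝 (upperDensity μ Λ)) :=
  tendsto_iInf_of_eventually_le
    (f := fun K : {K : Set G // IsCompact K ∧ 0 < μ.real K} => ⨆ x, pointDensity μ Λ K x)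
    (u := fun n => ⟨Kn n, hKn.isCompact n, hKn.measureReal_pos n⟩)
    ⟨0, Set.forall_mem_range.2 fun K => Real.iSup_nonneg (pointDensity_nonneg K.1)⟩
    fun K _ hε => hΛ.eventually_iSup_pointDensity_le hΛc hKn K.2.1 K.2.2 hε

theorem IsRelativelySeparated.exists_forall_pointDensity_le (hΛ : IsRelativelySeparated Λ)
    (hΛc : Λ.Countable) (hKn : IsStrongFolner μ Kn) :
    ∃ C, ∀ᶠ n in atTop, ∀ x, pointDensity μ Λ (Kn n) x ≤ C := by
  refine ⟨(⨆ x, pointDensity μ Λ (Kn 0) x) + 1, ?_⟩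
  filter_upwards [hΛ.eventually_iSup_pointDensity_le hΛc hKn (hKn.isCompact 0)
    (hKn.measureReal_pos 0) one_pos] with n hn x
  exact (le_ciSup (hΛ.bddAbove_pointDensity (hKn.isCompact n)) x).trans hn

theorem IsRelativelySeparated.tendsto_iInf_pointDensity (hΛ : IsRelativelySeparated Λ)
    (hΛc : Λ.Countable) (hKn : IsStrongFolner μ Kn) :
    Tendsto (fun n => ⨅ x, pointDensity μ Λ (Kn n) x) atTop (𝓝 (lowerDensity μ Λ)) := by
  obtain ⟨C, hC⟩ := hΛ.exists_forall_pointDensity_le hΛc hKn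
  refine tendsto_iSup_of_eventually_le
    (f := fun K : {K : Set G // IsCompact K ∧ 0 < μ.real K} => ⨅ x, pointDensity μ Λ K x)
    (u := fun n => ⟨Kn n, hKn.isCompact n, hKn.measureReal_pos n⟩)
    ⟨C + 1, Set.forall_mem_range.2 fun K => ?_⟩
    fun K _ hε => hΛ.eventually_iInf_pointDensity_le hΛc hKn K.2.1 K.2.2 hε
  obtain ⟨n, hnK, hnC⟩ :=
    ((hΛ.eventually_iInf_pointDensity_le hΛc hKn K.2.1 K.2.2 one_pos).and hC).exists
  linarith [(ciInf_le (bddBelow_pointDensity (Kn n)) 1).trans (hnC 1)]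

end Density

section Amalgam

variable {G : Type*} [MeasurableSpace G] {μ : Measure G}

theorem exists_isCompact_setLIntegral_compl_le [TopologicalSpace G] [T2Space G]
    [LocallyCompactSpace G] [SecondCountableTopology G] [BorelSpace G] {f : G → ℝ≥0∞}
    (hf : ∫⁻ x, f x ∂μ ≠ ∞) {ε : ℝ≥0∞} (hε : 0 < ε) :
    ∃ L : Set G, IsCompact L ∧ ∫⁻ x in Lᶜ, f x ∂μ ≤ ε := by
  have := isFiniteMeasure_withDensity hf
  obtain ⟨L, hL, hLε⟩ := isTightMeasureSet_iff_exists_isCompact_measure_compl_le.1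
    (isTightMeasureSet_singleton_of_innerRegular (μ := μ.withDensity f)) ε hε
  refine ⟨L, hL, ?_⟩
  rw [← withDensity_apply _ hL.measurableSet.compl]
  exact hLε _ rfl

theorem memLp_two_iff_lintegral_sq_enorm {F : G → ℂ} (hF : AEStronglyMeasurable F μ) :
    MemLp F 2 μ ↔ ∫⁻ x, ‖F x‖ₑ ^ 2 ∂μ < ∞ := by
  rw [MemLp, and_iff_right hF,
    eLpNorm_lt_top_iff_lintegral_rpow_enorm_lt_top two_ne_zero ENNReal.ofNat_ne_top]
  simp

variable [Group G] {Q : Set G} {f m : G → ℝ≥0∞}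

/-- The values of `f` are bounded by the values of `m` on the translates of `Q⁻¹`, up to null
sets. For integrable `m` this is the control that membership of `f` in a Wiener amalgam space
provides. -/
def IsLocallyDominated (μ : Measure G) (Q : Set G) (f m : G → ℝ≥0∞) : Prop :=
  ∀ᵐ p ∂μ.prod μ, p.2 ∈ Q → f p.1 ≤ m (p.1 / p.2)

theorem IsLocallyDominated.indicator_compl (h : IsLocallyDominated μ Q f m) (L : Set G) :
    IsLocallyDominated μ Q ((L * Q)ᶜ.indicator f) (Lᶜ.indicator m) := by
  classical
  filter_upwards [h] with p hp hpQ
  refine Set.indicator_apply_le' (fun hpL => ?_) fun _ => zero_le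
  have hdiv : p.1 / p.2 ∈ Lᶜ := fun hL => hpL ⟨_, hL, _, hpQ, div_mul_cancel _ _⟩
  rw [Set.indicator_of_mem hdiv]
  exact hp hpQ

theorem IsLocallyDominated.lintegral_le [MeasurableMul G] [SFinite μ] [μ.IsMulRightInvariant]
    (h : IsLocallyDominated μ Q f m) (hQ : μ Q ≠ 0) : ∫⁻ x, f x ∂μ ≤ ∫⁻ x, m x ∂μ := by
  have hswap : ∀ᵐ z ∂μ, ∀ᵐ x ∂μ, z ∈ Q → f x ≤ m (x / z) :=
    Measure.ae_ae_of_ae_prod (Measure.measurePreserving_swap.quasiMeasurePreserving.ae h)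
  obtain ⟨z, hzQ, hz⟩ := ((frequently_ae_mem_iff.2 hQ).and_eventually hswap).exists
  calc ∫⁻ x, f x ∂μ ≤ ∫⁻ x, m (x / z) ∂μ := lintegral_mono_ae (hz.mono fun _ hx => hx hzQ)
    _ = ∫⁻ x, m x ∂μ := lintegral_div_right_eq_self m z

theorem IsLocallyDominated.ae_mul_tsum_le [MeasurableMul₂ G] [MeasurableInv G] [SFinite μ]
    [μ.IsMulLeftInvariant] [μ.IsInvInvariant] (h : IsLocallyDominated μ Q f m)
    (hQ : MeasurableSet Q) (hm : Measurable m) {Λ : Set G} (hΛ : Λ.Countable) {N : ℝ≥0∞}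
    (hN : ∀ x : G, ((Λ ∩ x • Q).encard : ℝ≥0∞) ≤ N) :
    ∀ᵐ y ∂μ, μ Q * ∑' l : Λ, f (y⁻¹ * l) ≤ N * ∫⁻ x, m x ∂μ := by
  have := hΛ.to_subtype
  have hfibre : ∀ᵐ y ∂μ, ∀ l : Λ, ∀ᵐ z ∂μ, z ∈ Q → f (y⁻¹ * l) ≤ m (y⁻¹ * l / z) := by
    refine ae_all_iff.2 fun l => ?_
    have hqmp : Measure.QuasiMeasurePreserving (fun y => y⁻¹ * (l : G)) μ μ := by
      simpa only [Function.comp_def, mul_inv_rev, inv_inv] using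
        (quasiMeasurePreserving_inv μ).comp
          (measurePreserving_mul_left μ (l : G)⁻¹).quasiMeasurePreserving
    exact hqmp.ae (Measure.ae_ae_of_ae_prod h)
  filter_upwards [hfibre] with y hy
  set k : G → G → ℝ≥0∞ := fun l w => Q.indicator 1 (w⁻¹ * l) * m (y⁻¹ * w)
  have hk (l : G) : Measurable (k l) :=
    ((measurable_one.indicator hQ).comp (measurable_inv.mul_const l)).mul
      (hm.comp (measurable_const_mul _))
  have hle (l : Λ) : μ Q * f (y⁻¹ * l) ≤ ∫⁻ w, k l w ∂μ := by
    rw [mul_comm, ← setLIntegral_const, ← lintegral_div_left_eq_self (k l) l,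
      ← lintegral_indicator hQ]
    refine lintegral_mono_ae ((hy l).mono fun z hz => ?_)
    refine Set.indicator_apply_le' (fun hzQ => ?_) fun _ => zero_le
    simpa [k, hzQ, mul_div_assoc] using hz hzQ
  calc μ Q * ∑' l : Λ, f (y⁻¹ * l) ≤ ∑' l : Λ, ∫⁻ w, k l w ∂μ := by
        rw [← ENNReal.tsum_mul_left]
        exact ENNReal.tsum_le_tsum hle
    _ = ∫⁻ w, (Λ ∩ w • Q).encard * m (y⁻¹ * w) ∂μ := by
        rw [← lintegral_tsum fun l : Λ => (hk l).aemeasurable]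
        simp only [k, ENNReal.tsum_mul_right, tsum_indicator_inv_mul]
    _ ≤ ∫⁻ w, N * m (y⁻¹ * w) ∂μ := lintegral_mono fun w => by gcongr; exact hN w
    _ = N * ∫⁻ x, m x ∂μ := by
        rw [lintegral_mul_left_eq_self (fun w => N * m w), lintegral_const_mul _ hm]

theorem exists_isLocallyDominated_of_memLp_localMax [MeasurableMul₂ G] [MeasurableInv G]
    [SFinite μ] [μ.IsMulRightInvariant] {P : Set G} (hP : MeasurableSet P) (hPQ : P ⊆ Q)
    {F : G → ℂ} (hF : StronglyMeasurable F) (hM : MemLp (localMax μ Q F) 2 μ) :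
    ∃ m, Measurable m ∧ ∫⁻ x, m x ∂μ ≠ ∞ ∧ IsLocallyDominated μ P (fun x => ‖F x‖ₑ ^ 2) m := by
  obtain ⟨M, hMmeas, hMeq⟩ := hM.1.aemeasurable
  refine ⟨fun x => M x ^ 2, hMmeas.pow_const 2, ?_, ?_⟩
  · have hfin := lintegral_rpow_enorm_lt_top_of_eLpNorm_lt_top two_ne_zero ENNReal.ofNat_ne_top
      ((memLp_congr_ae hMeq).1 hM).2
    simpa using hfin.ne
  have hfibre : ∀ᵐ w ∂μ, ∀ᵐ z ∂μ, z ∈ P → ‖F (w * z)‖ₑ ^ 2 ≤ M w ^ 2 := by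
    filter_upwards [hMeq] with w hw
    rw [← hw, ← ae_restrict_iff' hP]
    exact ae_restrict_of_ae_restrict_of_subset hPQ
      ((ENNReal.ae_le_essSup _).mono fun z hz => pow_le_pow_left' hz 2)
  have hmeas : MeasurableSet
      {p : G × G | p.2 ∈ P → ‖F (p.1 * p.2)‖ₑ ^ 2 ≤ M p.1 ^ 2} :=
    (measurable_snd hP).imp (measurableSet_le
      ((hF.measurable.comp measurable_mul).enorm.pow_const 2)
      ((hMmeas.comp measurable_fst).pow_const 2))
  have hprod := (measurePreserving_div_prod μ μ).quasiMeasurePreserving.ae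
    ((Measure.ae_prod_iff_ae_ae hmeas).2 hfibre)
  exact hprod.mono fun p hp => by simpa only [div_mul_cancel] using hp

end Amalgam

section EssentialSupport

variable {G : Type*} [Group G] [TopologicalSpace G] [MeasurableSpace G] {μ : Measure G}

/-- Outside the symmetric compact set `L` the function `F` is `ε`-small in `L²`, and its samples
along almost all the translates `y⁻¹ Λ` are `ε`-small in `ℓ²`. -/
structure IsEssentialSupport (μ : Measure G) (Λ : Set G) (F : G → ℂ) (L : Set G) (ε : ℝ) :
    Prop where
  isCompact : IsCompact L
  inv_eq : L⁻¹ = L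
  setLIntegral_compl_le : ∫⁻ x in Lᶜ, ‖F x‖ₑ ^ 2 ∂μ ≤ ENNReal.ofReal (ε ^ 2)
  tsum_compl_le : ∀ᵐ y ∂μ,
    ∑' l : Λ, Lᶜ.indicator (fun x => ‖F x‖ₑ ^ 2) (y⁻¹ * l) ≤ ENNReal.ofReal (ε ^ 2)

variable [IsTopologicalGroup G] [T2Space G] [LocallyCompactSpace G] [SecondCountableTopology G]
  [BorelSpace G] {Λ Q : Set G} {F : G → ℂ}

theorem IsLocallyDominated.exists_isEssentialSupport [μ.IsHaarMeasure] [μ.IsMulRightInvariant]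
    [μ.IsInvInvariant] {m : G → ℝ≥0∞} (h : IsLocallyDominated μ Q (fun x => ‖F x‖ₑ ^ 2) m)
    (hQc : IsCompact Q) (hQ : Q ∈ 𝓝 1) (hm : Measurable m) (hm_fin : ∫⁻ x, m x ∂μ ≠ ∞)
    (hΛ : IsRelativelySeparated Λ) (hΛc : Λ.Countable) {ε : ℝ} (hε : 0 < ε) :
    ∃ L, IsEssentialSupport μ Λ F L ε := by
  obtain ⟨N, hN⟩ := hΛ Q hQc
  have hQ0 : μ Q ≠ 0 := (Measure.measure_pos_of_mem_nhds μ hQ).ne'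
  have hε0 : 0 < ENNReal.ofReal (ε ^ 2) := ENNReal.ofReal_pos.2 (by positivity)
  have hb : 0 < μ Q * ENNReal.ofReal (ε ^ 2) / N :=
    ENNReal.div_pos (mul_ne_zero hQ0 hε0.ne') (ENNReal.natCast_ne_top N)
  obtain ⟨L₀, hL₀, hδ⟩ := exists_isCompact_setLIntegral_compl_le hm_fin (lt_min hε0 hb)
  rw [← lintegral_indicator hL₀.measurableSet.compl] at hδ
  have hdom := h.indicator_compl L₀
  have hcompact : IsCompact (L₀ * Q) := hL₀.mul hQc
  have hsub : (L₀ * Q ∪ (L₀ * Q)⁻¹)ᶜ ⊆ (L₀ * Q)ᶜ :=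
    Set.compl_subset_compl.2 Set.subset_union_left
  refine ⟨L₀ * Q ∪ (L₀ * Q)⁻¹, hcompact.union hcompact.inv, ?_, ?_, ?_⟩
  · rw [Set.union_inv, inv_inv, Set.union_comm]
  · calc ∫⁻ x in (L₀ * Q ∪ (L₀ * Q)⁻¹)ᶜ, ‖F x‖ₑ ^ 2 ∂μ
        ≤ ∫⁻ x in (L₀ * Q)ᶜ, ‖F x‖ₑ ^ 2 ∂μ := lintegral_mono_set hsub
      _ = ∫⁻ x, (L₀ * Q)ᶜ.indicator (fun x => ‖F x‖ₑ ^ 2) x ∂μ :=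
        (lintegral_indicator hcompact.measurableSet.compl _).symm
      _ ≤ ∫⁻ x, L₀ᶜ.indicator m x ∂μ := hdom.lintegral_le hQ0
      _ ≤ ENNReal.ofReal (ε ^ 2) := hδ.trans (min_le_left _ _)
  · filter_upwards [hdom.ae_mul_tsum_le hQc.measurableSet
      (hm.indicator hL₀.measurableSet.compl) hΛc (N := N) fun x => mod_cast hN x] with y hy
    refine (ENNReal.mul_le_mul_iff_right hQ0 hQc.measure_lt_top.ne).1 ?_
    calc μ Q * ∑' l : Λ, (L₀ * Q ∪ (L₀ * Q)⁻¹)ᶜ.indicator (fun x => ‖F x‖ₑ ^ 2) (y⁻¹ * l)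
        ≤ μ Q * ∑' l : Λ, (L₀ * Q)ᶜ.indicator (fun x => ‖F x‖ₑ ^ 2) (y⁻¹ * l) := by
          gcongr
      _ ≤ N * ∫⁻ x, L₀ᶜ.indicator m x ∂μ := hy
      _ ≤ N * (μ Q * ENNReal.ofReal (ε ^ 2) / N) := by gcongr; exact hδ.trans (min_le_right _ _)
      _ ≤ μ Q * ENNReal.ofReal (ε ^ 2) := ENNReal.mul_div_le

variable [IsFiniteMeasureOnCompacts μ] [μ.IsMulLeftInvariant]

theorem isRelativelySeparated_of_tsum_inv_mul_le (hΛ : Λ.Countable) {f : G → ℝ≥0∞}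
    (hf : Measurable f) (hf0 : ∫⁻ y, f y ∂μ ≠ 0) {S : ℝ≥0∞} (hS : S ≠ ∞)
    (h : ∀ y, ∑' l : Λ, f ((l : G)⁻¹ * y) ≤ S) : IsRelativelySeparated Λ := by
  intro K hK
  obtain ⟨n, hn⟩ : ∃ n, 0 < μ.withDensity f (compactCovering G n) :=
    exists_measure_pos_of_not_measure_iUnion_null (by
      simpa only [iUnion_compactCovering, withDensity_apply _ .univ, setLIntegral_univ] using hf0)
  set W := compactCovering G n
  have hW : IsCompact W := isCompact_compactCovering G n
  rw [withDensity_apply _ hW.measurableSet] at hn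
  have hfin : S * μ (K * W) ≠ ∞ := ENNReal.mul_ne_top hS (hK.mul hW).measure_lt_top.ne
  obtain ⟨N, hN⟩ := ENNReal.exists_nat_gt (ENNReal.div_ne_top hfin hn.ne')
  refine ⟨N, fun x => ?_⟩
  have hcount := encard_inter_mul_setLIntegral_le (μ := μ) hΛ (x • K) hW.measurableSet hf h
  rw [smul_mul_assoc, measure_smul,
    ← ENNReal.le_div_iff_mul_le (.inl hn.ne') (.inr hfin)] at hcount
  exact_mod_cast hcount.trans hN.le

end EssentialSupport

section Sampling

variable {G H : Type*} [NormedAddCommGroup H] [InnerProductSpace ℂ H] [Group G]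
  [MeasurableSpace G] {μ : Measure G} {π : G → H ≃ₗᵢ[ℂ] H} {g : H}
  {Λ : Set G} {B : ℝ}

theorem IsProjectiveRep.countable_of_isBessel (hπ : IsProjectiveRep π) (hg : g ≠ 0)
    (h : IsBessel (fun l : Λ => π l g) B) : Λ.Countable :=
  Set.countable_coe_iff.1 <| h.countable
    ((hπ.stronglyMeasurable g).isSeparable_range.mono
      (Set.range_comp_subset_range ((↑) : Λ → G) fun x => π x g))
    fun l => by simpa using hg

variable [TopologicalSpace G] [IsTopologicalGroup G] [T2Space G] [LocallyCompactSpace G]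
  [SecondCountableTopology G] [BorelSpace G] [IsFiniteMeasureOnCompacts μ] [μ.IsMulLeftInvariant]

theorem IsProjectiveRep.isRelativelySeparated_of_isBessel (hπ : IsProjectiveRep π) (hg : g ≠ 0)
    {c : ℝ} (hc : IsAdmissible μ π g c) (h : IsBessel (fun l : Λ => π l g) B) :
    IsRelativelySeparated Λ := by
  have hmeas : Measurable fun y => ‖coeff π g g y‖ₑ ^ 2 :=
    (hπ.stronglyMeasurable_coeff g g).measurable.enorm.pow_const 2
  refine isRelativelySeparated_of_tsum_inv_mul_le (μ := μ) (hπ.countable_of_isBessel hg h) hmeas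
    (fun h0 => ?_) (S := ENNReal.ofReal (B * ‖g‖ ^ 2)) ENNReal.ofReal_ne_top fun y => ?_
  · have hae : (fun y => ‖coeff π g g y‖ ^ 2) =ᵐ[μ] 0 :=
      ((lintegral_eq_zero_iff hmeas).1 h0).mono fun y hy => by simpa using hy
    have hint := hc.integral_norm_coeff_sq g
    rw [integral_congr_ae hae] at hint
    have := hc.pos
    have : 0 < c * ‖g‖ ^ 2 := by positivity
    simp_all
  · calc ∑' l : Λ, ‖coeff π g g ((l : G)⁻¹ * y)‖ₑ ^ 2
        = ∑' l : Λ, ENNReal.ofReal (‖inner ℂ (π l g) (π y g)‖ ^ 2) := by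
          simp_rw [← ofReal_norm, ← hπ.norm_coeff_apply_self,
            ← ENNReal.ofReal_pow (norm_nonneg _)]
          rfl
      _ = ENNReal.ofReal (∑' l : Λ, ‖inner ℂ (π l g) (π y g)‖ ^ 2) :=
          (ENNReal.ofReal_tsum_of_nonneg (fun _ => by positivity) (h (π y g)).1).symm
      _ ≤ ENNReal.ofReal (B * ‖g‖ ^ 2) := by
          rw [← (π y).norm_map g]
          exact ENNReal.ofReal_le_ofReal (h (π y g)).2

end Sampling

section Reconstruction

variable {ι H : Type*} [NormedAddCommGroup H] [InnerProductSpace ℂ H]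

theorem norm_le_of_hasSum_mul {a b : ι → ℂ} {z : ℂ} (h : HasSum (fun i => a i * b i) z)
    (ha : Summable fun i => ‖a i‖ ^ 2) (hb : Summable fun i => ‖b i‖ ^ 2) :
    ‖z‖ ≤ √(∑' i, ‖a i‖ ^ 2) * √(∑' i, ‖b i‖ ^ 2) := by
  have hholder := Real.summable_and_inner_le_Lp_mul_Lq_tsum_of_nonneg Real.HolderConjugate.two_two
    (fun i => norm_nonneg (a i)) (fun i => norm_nonneg (b i)) (by simpa using ha)
    (by simpa using hb)
  simp only [← norm_mul, Real.rpow_two, ← Real.sqrt_eq_rpow] at hholder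
  rw [← h.tsum_eq]
  exact (norm_tsum_le_tsum_norm hholder.1).trans hholder.2

theorem hasSum_sdiff {G M : Type*} [AddCommGroup M] [TopologicalSpace M] [IsTopologicalAddGroup M]
    {Λ E : Set G} {f : G → M} {z : M} (hf : HasSum (fun l : Λ => f l) z)
    (hfin : (Λ ∩ E).Finite) :
    HasSum (fun l : (Λ \ E : Set G) => f l) (z - ∑ l ∈ hfin.toFinset, f l) := by
  classical
  have hinter : HasSum ((Λ ∩ E).indicator f) (∑ l ∈ hfin.toFinset, f l) := by
    rw [← Finset.sum_congr rfl fun l hl => Set.indicator_of_mem (hfin.mem_toFinset.1 hl) f]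
    exact hasSum_sum_of_ne_finset_zero fun l hl =>
      Set.indicator_of_notMem (hfin.mem_toFinset.not.1 hl) f
  refine (hasSum_subtype_iff_indicator (s := Λ \ E)).2 ?_
  have hdiff := ((hasSum_subtype_iff_indicator (s := Λ)).1 hf).sub hinter
  refine hdiff.congr_fun fun l => ?_
  by_cases hl : l ∈ Λ <;> by_cases hlE : l ∈ E <;> simp [hl, hlE]

end Reconstruction

section FrameKernel

variable {G H : Type*} [NormedAddCommGroup H] [InnerProductSpace ℂ H] {π : G → H ≃ₗᵢ[ℂ] H}
  {g : H} {Λ : Set G} {d : G → H} {B c : ℝ}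

/-- The contribution of `l` to the reconstruction formula for `‖g‖² = ⟨π y g, π y g⟩`. Its sum
over `l ∈ Λ` is `‖g‖²`, and its integral over `y` is proportional to `⟨π l g, d l⟩`. -/
noncomputable def frameKernel (π : G → H ≃ₗᵢ[ℂ] H) (g : H) (d : G → H) (l y : G) : ℂ :=
  conj (coeff π g (d l) y) * coeff π g (π l g) y

theorem IsDualFrame.hasSum_frameKernel (hd : IsDualFrame π g Λ d B) (y : G) :
    HasSum (fun l : Λ => frameKernel π g d l y) ((‖g‖ ^ 2 : ℝ) : ℂ) := by
  have hsum := (hd.hasSum (π y g)).mapL (innerSL ℂ (π y g))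
  rw [innerSL_apply_apply, inner_self_eq_norm_sq_to_K, LinearIsometryEquiv.norm_map] at hsum
  push_cast
  refine hsum.congr_fun fun l => ?_
  rw [innerSL_apply_apply, inner_smul_right, frameKernel, coeff, coeff, inner_conj_symm]

theorem IsDualFrame.norm_sub_sum_frameKernel_le (hd : IsDualFrame π g Λ d B) {E : Set G}
    (hfin : (Λ ∩ E).Finite) (y : G) :
    ‖((‖g‖ ^ 2 : ℝ) : ℂ) - ∑ l ∈ hfin.toFinset, frameKernel π g d l y‖ ≤
      √B * ‖g‖ * √(∑' l : (Λ \ E : Set G), ‖coeff π g (π l g) y‖ ^ 2) := by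
  have hinj : Function.Injective (Set.inclusion (Set.sdiff_subset : Λ \ E ⊆ Λ)) :=
    Set.inclusion_injective _
  have hframe := hd.bessel.comp_injective hinj
  have hdual := hd.bessel_dual.comp_injective hinj
  have hdual_norm (l : G) : ‖conj (coeff π g (d l) y)‖ = ‖inner ℂ (d l) (π y g)‖ := by
    rw [coeff, inner_conj_symm]
  have hframe_norm (l : G) : ‖coeff π g (π l g) y‖ = ‖inner ℂ (π l g) (π y g)‖ := by
    rw [coeff, norm_inner_symm]
  have hrem := hasSum_sdiff (f := fun l => frameKernel π g d l y) (hd.hasSum_frameKernel y) hfin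
  refine (norm_le_of_hasSum_mul (a := fun l : (Λ \ E : Set G) => conj (coeff π g (d l) y))
    (b := fun l : (Λ \ E : Set G) => coeff π g (π l g) y) hrem ?_ ?_).trans ?_
  · simp only [hdual_norm]
    exact (hdual (π y g)).1
  · simp only [hframe_norm]
    exact (hframe (π y g)).1
  · gcongr
    simpa only [hdual_norm, LinearIsometryEquiv.norm_map] using hdual.sqrt_tsum_le (π y g)

end FrameKernel

section LocalTrace

variable {G H : Type*} [NormedAddCommGroup H] [InnerProductSpace ℂ H] {π : G → H ≃ₗᵢ[ℂ] H}
  {g : H} {Λ E L : Set G} {d : G → H} {B c ε : ℝ}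

section Admissible

variable [MeasurableSpace G] {μ : Measure G}

theorem IsAdmissible.integrable_frameKernel (hc : IsAdmissible μ π g c) (d : G → H) (l : G) :
    Integrable (frameKernel π g d l) μ :=
  integrable_conj_mul (hc.memLp_coeff _) (hc.memLp_coeff _)

theorem IsAdmissible.integral_frameKernel (hc : IsAdmissible μ π g c) (d : G → H) (l : G) :
    ∫ y, frameKernel π g d l y ∂μ = c * inner ℂ (d l) (π l g) :=
  hc.integral_conj_coeff_mul_coeff _ _

theorem IsAdmissible.sqrt_setIntegral_norm_coeff_sq_le (hc : IsAdmissible μ π g c) (f : H)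
    (E : Set G) : √(∫ y in E, ‖coeff π g f y‖ ^ 2 ∂μ) ≤ √c * ‖f‖ := by
  rw [← Real.sqrt_sq (norm_nonneg f), ← Real.sqrt_mul hc.pos.le, ← hc.integral_norm_coeff_sq]
  exact Real.sqrt_le_sqrt (setIntegral_le_integral (integrable_norm_sq (hc.memLp_coeff f))
    (ae_of_all _ fun _ => by positivity))

theorem IsAdmissible.norm_setIntegral_frameKernel_le (hc : IsAdmissible μ π g c)
    (hd : IsDualFrame π g Λ d B) {l : G} (hl : l ∈ Λ) (E : Set G) :
    ‖∫ y in E, frameKernel π g d l y ∂μ‖ ≤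
      √c * √B * √(∫ y in E, ‖coeff π g (π l g) y‖ ^ 2 ∂μ) := by
  refine (norm_integral_conj_mul_le ((hc.memLp_coeff _).restrict E)
    ((hc.memLp_coeff _).restrict E)).trans ?_
  gcongr
  refine (hc.sqrt_setIntegral_norm_coeff_sq_le (d l) E).trans ?_
  gcongr
  exact hd.bessel_dual.norm_le_sqrt ⟨l, hl⟩

theorem IsAdmissible.mul_sum_inner_sub_eq (hc : IsAdmissible μ π g c) (d : G → H)
    (hE : MeasurableSet E) (hμE : μ E ≠ ∞) (s : Finset G) :
    c * ∑ l ∈ s, inner ℂ (d l) (π l g) - ((‖g‖ ^ 2 * μ.real E : ℝ) : ℂ) =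
      ∑ l ∈ s, ∫ y in Eᶜ, frameKernel π g d l y ∂μ -
        ∫ y in E, (((‖g‖ ^ 2 : ℝ) : ℂ) - ∑ l ∈ s, frameKernel π g d l y) ∂μ := by
  have hint (l : G) := hc.integrable_frameKernel d l
  have hconst : IntegrableOn (fun _ : G => ((‖g‖ ^ 2 : ℝ) : ℂ)) E μ := integrableOn_const hμE
  rw [integral_sub hconst (integrable_finsetSum _ fun l _ =>
    (hint l).integrableOn), integral_finsetSum _ fun l _ => (hint l).integrableOn,
    setIntegral_const, Finset.mul_sum, sub_sub_eq_add_sub, ← Finset.sum_add_distrib]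
  simp only [← hc.integral_frameKernel, ← integral_add_compl hE (hint _), add_comm,
    Complex.real_smul]
  push_cast
  ring

end Admissible

theorem IsDualFrame.norm_sub_sum_frameKernel_le_sq (hd : IsDualFrame π g Λ d B)
    (hfin : (Λ ∩ E).Finite) (y : G) :
    ‖((‖g‖ ^ 2 : ℝ) : ℂ) - ∑ l ∈ hfin.toFinset, frameKernel π g d l y‖ ≤
      √B * ‖g‖ * (√B * ‖g‖) := by
  refine (hd.norm_sub_sum_frameKernel_le hfin y).trans ?_
  gcongr
  have htail := (hd.bessel.comp_injective
    (Set.inclusion_injective (Set.sdiff_subset : Λ \ E ⊆ Λ))).sqrt_tsum_le (π y g)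
  simpa only [coeff, norm_inner_symm (π y g), LinearIsometryEquiv.norm_map] using htail

variable [Group G] [MeasurableSpace G] {μ : Measure G}

section

variable [TopologicalSpace G]

theorem IsEssentialSupport.ae_tsum_norm_coeff_sq_le (hπ : IsProjectiveRep π)
    (hL : IsEssentialSupport μ Λ (coeff π g g) L ε) (E : Set G) :
    ∀ᵐ y ∂μ, y ∉ Eᶜ * L → ∑' l : (Λ \ E : Set G), ‖coeff π g (π l g) y‖ ^ 2 ≤ ε ^ 2 := by
  filter_upwards [hL.tsum_compl_le] with y hy hyE
  have hmem (l : (Λ \ E : Set G)) : y⁻¹ * (l : G) ∈ Lᶜ := fun hl =>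
    hyE ⟨l, l.2.2, (l : G)⁻¹ * y, by rw [← hL.inv_eq]; simpa using hl, by simp⟩
  have htail : ∑' l : (Λ \ E : Set G), ‖coeff π g (π l g) y‖ₑ ^ 2 ≤ ENNReal.ofReal (ε ^ 2) := calc
    _ = ∑' l : (Λ \ E : Set G), Lᶜ.indicator (fun x => ‖coeff π g g x‖ₑ ^ 2) (y⁻¹ * l) := by
      refine tsum_congr fun l => ?_
      rw [Set.indicator_of_mem (hmem l), ← ofReal_norm, hπ.norm_coeff_apply_self, ofReal_norm]
    _ ≤ ∑' l : Λ, Lᶜ.indicator (fun x => ‖coeff π g g x‖ₑ ^ 2) (y⁻¹ * l) :=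
      ENNReal.tsum_mono_subtype (fun l => Lᶜ.indicator _ (y⁻¹ * l)) Set.sdiff_subset
    _ ≤ ENNReal.ofReal (ε ^ 2) := hy
  have hreal := ENNReal.toReal_le_of_le_ofReal (by positivity) htail
  rw [ENNReal.tsum_toReal_eq fun l => by finiteness] at hreal
  simpa using hreal

theorem IsEssentialSupport.ae_norm_sub_sum_frameKernel_le (hπ : IsProjectiveRep π)
    (hd : IsDualFrame π g Λ d B) (hL : IsEssentialSupport μ Λ (coeff π g g) L ε) (hε : 0 ≤ ε)
    (hfin : (Λ ∩ E).Finite) :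
    ∀ᵐ y ∂μ, y ∉ Eᶜ * L →
      ‖((‖g‖ ^ 2 : ℝ) : ℂ) - ∑ l ∈ hfin.toFinset, frameKernel π g d l y‖ ≤ √B * ‖g‖ * ε := by
  filter_upwards [hL.ae_tsum_norm_coeff_sq_le hπ E] with y hy hyE
  refine (hd.norm_sub_sum_frameKernel_le hfin y).trans ?_
  gcongr
  exact Real.sqrt_le_left hε |>.2 (hy hyE)

variable [IsTopologicalGroup G] [BorelSpace G]

theorem IsEssentialSupport.norm_setIntegral_sub_sum_frameKernel_le (hπ : IsProjectiveRep π)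
    (hd : IsDualFrame π g Λ d B) (hL : IsEssentialSupport μ Λ (coeff π g g) L ε) (hε : 0 ≤ ε)
    (hE : IsClosed E) (hμE : μ E ≠ ∞) (hfin : (Λ ∩ E).Finite) :
    ‖∫ y in E, (((‖g‖ ^ 2 : ℝ) : ℂ) - ∑ l ∈ hfin.toFinset, frameKernel π g d l y) ∂μ‖ ≤
      √B * ‖g‖ * (ε * μ.real E + √B * ‖g‖ * μ.real (innerBoundary E L)) := by
  have : IsFiniteMeasure (μ.restrict E) := ⟨by simpa using hμE.lt_top⟩
  have hmeas : MeasurableSet (Eᶜ * L) := hE.isOpen_compl.mul_right.measurableSet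
  have hbound : ∀ᵐ y ∂μ.restrict E,
      ‖((‖g‖ ^ 2 : ℝ) : ℂ) - ∑ l ∈ hfin.toFinset, frameKernel π g d l y‖ ≤
        √B * ‖g‖ * ε + (Eᶜ * L).indicator (fun _ => √B * ‖g‖ * (√B * ‖g‖)) y := by
    refine ae_restrict_of_ae ?_
    filter_upwards [hL.ae_norm_sub_sum_frameKernel_le hπ hd hε hfin] with y hy
    by_cases hyL : y ∈ Eᶜ * L
    · rw [Set.indicator_of_mem hyL]
      exact (hd.norm_sub_sum_frameKernel_le_sq hfin y).trans
        (le_add_of_nonneg_left (by positivity))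
    · simpa [hyL] using hy hyL
  refine (norm_integral_le_of_norm_le ((integrable_const _).add
    ((integrable_const _).indicator hmeas)) hbound).trans_eq ?_
  rw [integral_add' (integrable_const _) ((integrable_const _).indicator hmeas),
    integral_indicator_const _ hmeas, setIntegral_const, measureReal_restrict_apply hmeas,
    Set.inter_comm, innerBoundary, smul_eq_mul, smul_eq_mul]
  ring

variable [T2Space G]

theorem IsEssentialSupport.setIntegral_compl_norm_coeff_sq_le [μ.IsMulLeftInvariant]
    (hπ : IsProjectiveRep π) (hL : IsEssentialSupport μ Λ (coeff π g g) L ε)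
    (hE : MeasurableSet E) {l : G} (hl : l ∉ Eᶜ * L) :
    ∫ y in Eᶜ, ‖coeff π g (π l g) y‖ ^ 2 ∂μ ≤ ε ^ 2 := by
  have hLm := hL.isCompact.measurableSet.compl
  have hmem {y : G} (hy : y ∈ Eᶜ) : l⁻¹ * y ∈ Lᶜ := fun hyL =>
    hl ⟨y, hy, y⁻¹ * l, by rw [← hL.inv_eq]; simpa using hyL, by simp⟩
  have htail : ∫⁻ y in Eᶜ, ‖coeff π g (π l g) y‖ₑ ^ 2 ∂μ ≤ ENNReal.ofReal (ε ^ 2) := calc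
    _ ≤ ∫⁻ y, Lᶜ.indicator (fun x => ‖coeff π g g x‖ₑ ^ 2) (l⁻¹ * y) ∂μ := by
      rw [← lintegral_indicator hE.compl]
      refine lintegral_mono (Set.indicator_le fun y hy => ?_)
      rw [Set.indicator_of_mem (hmem hy), ← ofReal_norm, hπ.norm_coeff_apply, ofReal_norm]
    _ = ∫⁻ x in Lᶜ, ‖coeff π g g x‖ₑ ^ 2 ∂μ := by
      rw [lintegral_mul_left_eq_self (Lᶜ.indicator _), lintegral_indicator hLm]
    _ ≤ ENNReal.ofReal (ε ^ 2) := hL.setLIntegral_compl_le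
  have hmeas : StronglyMeasurable fun y => ‖coeff π g (π l g) y‖ ^ 2 :=
    (hπ.stronglyMeasurable_coeff g _).norm.pow 2
  rw [integral_eq_lintegral_of_nonneg_ae (ae_of_all _ fun _ => by positivity)
    hmeas.aestronglyMeasurable]
  refine ENNReal.toReal_le_of_le_ofReal (by positivity) ?_
  simpa only [ENNReal.ofReal_pow (norm_nonneg _), ofReal_norm] using htail

theorem IsEssentialSupport.norm_setIntegral_compl_frameKernel_le [μ.IsMulLeftInvariant]
    (hπ : IsProjectiveRep π) (hc : IsAdmissible μ π g c) (hd : IsDualFrame π g Λ d B)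
    (hL : IsEssentialSupport μ Λ (coeff π g g) L ε) (hε : 0 ≤ ε) (hE : MeasurableSet E) {l : G}
    (hl : l ∈ Λ) :
    ‖∫ y in Eᶜ, frameKernel π g d l y ∂μ‖ ≤
      √c * √B * (ε + (Eᶜ * L).indicator (fun _ => √c * ‖g‖) l) := by
  refine (hc.norm_setIntegral_frameKernel_le hd hl Eᶜ).trans ?_
  gcongr
  by_cases hlE : l ∈ Eᶜ * L
  · rw [Set.indicator_of_mem hlE, ← (π l).norm_map g]
    exact (hc.sqrt_setIntegral_norm_coeff_sq_le _ _).trans (le_add_of_nonneg_left hε)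
  · rw [Set.indicator_of_notMem hlE, add_zero, Real.sqrt_le_left hε]
    exact hL.setIntegral_compl_norm_coeff_sq_le hπ hE hlE

theorem IsEssentialSupport.norm_sum_setIntegral_compl_frameKernel_le [μ.IsMulLeftInvariant]
    (hπ : IsProjectiveRep π) (hc : IsAdmissible μ π g c) (hd : IsDualFrame π g Λ d B)
    (hL : IsEssentialSupport μ Λ (coeff π g g) L ε) (hε : 0 ≤ ε) (hE : MeasurableSet E)
    (hfin : (Λ ∩ E).Finite) :
    ‖∑ l ∈ hfin.toFinset, ∫ y in Eᶜ, frameKernel π g d l y ∂μ‖ ≤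
      √c * √B * (ε * (Λ ∩ E).ncard + √c * ‖g‖ * (Λ ∩ innerBoundary E L).ncard) := by
  have hboundary : ∑ l ∈ hfin.toFinset, (Eᶜ * L).indicator (fun _ => √c * ‖g‖) l =
      √c * ‖g‖ * (Λ ∩ innerBoundary E L).ncard := by
    classical
    rw [Finset.sum_indicator_eq_sum_filter, Finset.sum_const, nsmul_eq_mul, mul_comm,
      ← Set.ncard_coe_finset, Finset.coe_filter]
    simp only [Set.Finite.mem_toFinset, innerBoundary, ← Set.inter_assoc]
    rfl
  calc
    _ ≤ ∑ l ∈ hfin.toFinset,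
        √c * √B * (ε + (Eᶜ * L).indicator (fun _ => √c * ‖g‖) l) :=
      norm_sum_le_of_le _ fun l hl => hL.norm_setIntegral_compl_frameKernel_le hπ hc hd hε hE
        (hfin.mem_toFinset.1 hl).1
    _ = _ := by
      rw [← Finset.mul_sum, Finset.sum_add_distrib, hboundary, Finset.sum_const, nsmul_eq_mul,
        ← Set.ncard_eq_toFinset_card _ hfin, mul_comm ε]

/-- The trace over `Λ ∩ E` of the matrix `(⟨π k g, d l⟩)` of the reconstruction. -/
noncomputable def localTrace (π : G → H ≃ₗᵢ[ℂ] H) (g : H) (d : G → H) (Λ E : Set G) : ℝ :=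
  ∑ᶠ l ∈ Λ ∩ E, (inner ℂ (d l) (π l g)).re

theorem IsEssentialSupport.abs_mul_localTrace_sub_le [μ.IsMulLeftInvariant]
    (hπ : IsProjectiveRep π) (hc : IsAdmissible μ π g c) (hd : IsDualFrame π g Λ d B)
    (hL : IsEssentialSupport μ Λ (coeff π g g) L ε) (hε : 0 ≤ ε) (hE : IsClosed E)
    (hμE : μ E ≠ ∞) (hfin : (Λ ∩ E).Finite) :
    |c * localTrace π g d Λ E - ‖g‖ ^ 2 * μ.real E| ≤
      √c * √B * (ε * (Λ ∩ E).ncard + √c * ‖g‖ * (Λ ∩ innerBoundary E L).ncard) +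
        √B * ‖g‖ * (ε * μ.real E + √B * ‖g‖ * μ.real (innerBoundary E L)) := by
  have htrace : c * localTrace π g d Λ E - ‖g‖ ^ 2 * μ.real E =
      (c * ∑ l ∈ hfin.toFinset, inner ℂ (d l) (π l g) - ((‖g‖ ^ 2 * μ.real E : ℝ) : ℂ)).re := by
    rw [localTrace, finsum_mem_eq_finite_toFinset_sum _ hfin, Complex.sub_re, Complex.re_ofReal_mul,
      Complex.re_sum, Complex.ofReal_re]
  rw [htrace, hc.mul_sum_inner_sub_eq d hE.measurableSet hμE]
  exact (Complex.abs_re_le_norm _).trans <| (norm_sub_le _ _).trans <| add_le_add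
    (hL.norm_sum_setIntegral_compl_frameKernel_le hπ hc hd hε hE.measurableSet hfin)
    (hL.norm_setIntegral_sub_sum_frameKernel_le hπ hd hε hE hμE hfin)

end

end LocalTrace

section Asymptotics

variable {G : Type*} [Group G] [TopologicalSpace G] [IsTopologicalGroup G] [T2Space G]
  [MeasurableSpace G] [BorelSpace G] {μ : Measure G} [IsFiniteMeasureOnCompacts μ]
  [μ.IsMulLeftInvariant] [μ.IsInvInvariant] {Λ : Set G} {K : ℕ → Set G}

theorem IsRelativelySeparated.eventually_ncard_inter_innerBoundary_le
    (hΛ : IsRelativelySeparated Λ) (hΛc : Λ.Countable) (hK : IsStrongFolner μ K) {L : Set G}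
    (hL : IsCompact L) {δ : ℝ} (hδ : 0 < δ) :
    ∀ᶠ n in atTop, ∀ x : G, (Λ ∩ innerBoundary (x • K n) L).ncard ≤ δ * μ.real (K n) := by
  set V := K 0
  have hV : IsCompact V := hK.isCompact 0
  have hV0 : 0 < μ.real V := hK.measureReal_pos 0
  obtain ⟨N, hN⟩ := hΛ V hV
  have hN' (y : G) : ((Λ ∩ y • V).ncard : ℝ) ≤ N := mod_cast
    (Nat.cast_le (α := ℕ∞)).1 ((hΛ.finite (hV.smul y)).cast_ncard_eq.trans_le (hN y))
  obtain ⟨η, hη, hNη⟩ := exists_pos_mul_lt (mul_pos hδ hV0) (N : ℝ)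
  filter_upwards [hK.eventually_measureReal_innerBoundary_mul_le hL hV.inv (hK.nonempty 0).inv hη]
    with n hn x
  have hcount := hΛ.ncard_inter_mul_measureReal_le (μ := μ) hΛc Set.inter_subset_left
    ((hK.isCompact n).smul x) hV hN' (D := innerBoundary (x • K n) L)
  rw [smul_innerBoundary, smul_mul_assoc, measureReal_def μ (x • _), measure_smul,
    ← measureReal_def] at hcount
  refine le_of_mul_le_mul_right ?_ hV0
  calc ((Λ ∩ innerBoundary (x • K n) L).ncard : ℝ) * μ.real V
      ≤ N * μ.real (innerBoundary (K n) L * V⁻¹) := by rwa [smul_innerBoundary]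
    _ ≤ N * (η * μ.real (K n)) := by gcongr
    _ = N * η * μ.real (K n) := by ring
    _ ≤ δ * μ.real V * μ.real (K n) := by gcongr
    _ = δ * μ.real (K n) * μ.real V := by ring

variable {H : Type*} [NormedAddCommGroup H] [InnerProductSpace ℂ H] {π : G → H ≃ₗᵢ[ℂ] H}
  {g : H} {d : G → H} {B c : ℝ}

theorem IsDualFrame.tendstoUniformly_localTrace_div (hπ : IsProjectiveRep π)
    (hc : IsAdmissible μ π g c) (hd : IsDualFrame π g Λ d B) (hΛ : IsRelativelySeparated Λ)
    (hΛc : Λ.Countable) (hL : ∀ ε > 0, ∃ L, IsEssentialSupport μ Λ (coeff π g g) L ε)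
    (hK : IsStrongFolner μ K) :
    TendstoUniformly (fun n (x : G) => localTrace π g d Λ (x • K n) / μ.real (K n))
      (fun _ => ‖g‖ ^ 2 / c) atTop := by
  refine Metric.tendstoUniformly_iff.2 fun ε hε => ?_
  obtain ⟨C, hC⟩ := hΛ.exists_forall_pointDensity_le hΛc hK
  obtain ⟨t, ht, htε⟩ := exists_pos_mul_lt (mul_pos hε hc.pos)
    (√c * √B * (C + √c * ‖g‖) + √B * ‖g‖ * (1 + √B * ‖g‖))
  obtain ⟨L, hL⟩ := hL t ht
  filter_upwards [hC, hK.eventually_measureReal_innerBoundary_le hL.isCompact ht,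
    hΛ.eventually_ncard_inter_innerBoundary_le hΛc hK hL.isCompact ht] with n hcount hμ hncard x
  have hpos := hK.measureReal_pos n
  have hsmul (s : Set G) : μ.real (x • s) = μ.real s := by
    rw [measureReal_def, measure_smul, measureReal_def]
  have hcompact : IsCompact (x • K n) := (hK.isCompact n).smul x
  have hcount := (div_le_iff₀ hpos).1 (hcount x)
  have htrace := hL.abs_mul_localTrace_sub_le hπ hc hd ht.le hcompact.isClosed
    hcompact.measure_lt_top.ne (hΛ.finite hcompact)
  have hboundary : μ.real (innerBoundary (x • K n) L) = μ.real (innerBoundary (K n) L) := by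
    rw [smul_innerBoundary, hsmul]
  rw [hsmul, hboundary] at htrace
  have hbound : |c * localTrace π g d Λ (x • K n) - ‖g‖ ^ 2 * μ.real (K n)| <
      ε * c * μ.real (K n) := calc
    _ ≤ √c * √B * (t * (C * μ.real (K n)) + √c * ‖g‖ * (t * μ.real (K n))) +
          √B * ‖g‖ * (t * μ.real (K n) + √B * ‖g‖ * (t * μ.real (K n))) :=
      htrace.trans (by gcongr; exact hncard x)
    _ = (√c * √B * (C + √c * ‖g‖) + √B * ‖g‖ * (1 + √B * ‖g‖)) * t * μ.real (K n) := by ring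
    _ < ε * c * μ.real (K n) := by gcongr
  have hdiv : localTrace π g d Λ (x • K n) / μ.real (K n) - ‖g‖ ^ 2 / c =
      (c * localTrace π g d Λ (x • K n) - ‖g‖ ^ 2 * μ.real (K n)) / (c * μ.real (K n)) := by
    have := hc.pos.ne'
    field_simp
  have hcμ : 0 < c * μ.real (K n) := mul_pos hc.pos hpos
  rwa [dist_comm, Real.dist_eq, hdiv, abs_div, abs_of_pos hcμ, div_lt_iff₀ hcμ, ← mul_assoc]

end Asymptotics

section Extrema

theorem abs_iInf_mul_iSup_sub_le {ι : Type*} [Nonempty ι] {a r : ι → ℝ} {D ε : ℝ}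
    (ha : ∀ i, 0 ≤ a i) (hr : ∀ i, 0 ≤ r i) (hbdd : BddAbove (Set.range r))
    (h : ∀ i, |a i * r i - D| ≤ ε) : |(⨅ i, a i) * (⨆ i, r i) - D| ≤ ε := by
  refine abs_sub_le_iff.2 ⟨sub_le_iff_le_add.2 ?_, sub_le_comm.1 ?_⟩
  · rw [Real.mul_iSup_of_nonneg (Real.iInf_nonneg ha)]
    refine ciSup_le fun i => le_trans ?_ (sub_le_iff_le_add.1 (abs_sub_le_iff.1 (h i)).1)
    exact mul_le_mul_of_nonneg_right (ciInf_le ⟨0, Set.forall_mem_range.2 ha⟩ i) (hr i)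
  · rw [Real.iInf_mul_of_nonneg (Real.iSup_nonneg hr)]
    refine le_ciInf fun i => (sub_le_comm.1 (abs_sub_le_iff.1 (h i)).2).trans ?_
    exact mul_le_mul_of_nonneg_left (le_ciSup hbdd i) (ha i)

theorem tendsto_iInf_mul_iSup {ι : Type*} [Nonempty ι] {a r : ℕ → ι → ℝ} {D : ℝ}
    (ha : ∀ n i, 0 ≤ a n i) (hr : ∀ n i, 0 ≤ r n i) (hbdd : ∀ n, BddAbove (Set.range (r n)))
    (h : TendstoUniformly (fun n i => a n i * r n i) (fun _ => D) atTop) :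
    Tendsto (fun n => (⨅ i, a n i) * ⨆ i, r n i) atTop (𝓝 D) := by
  refine Metric.tendsto_nhds.2 fun ε hε => ?_
  filter_upwards [Metric.tendstoUniformly_iff.1 h (ε / 2) (half_pos hε)] with n hn
  refine lt_of_le_of_lt ?_ (half_lt_self hε)
  refine abs_iInf_mul_iSup_sub_le (ha n) (hr n) (hbdd n) fun i => ?_
  rw [← Real.dist_eq, dist_comm]
  exact (hn i).le

theorem tendsto_div_of_tendsto_mul {u v : ℕ → ℝ} {D s : ℝ} (hD : 0 < D) (hu : ∀ n, u n ≤ 1)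
    (hv : ∀ n, 0 ≤ v n) (huv : Tendsto (fun n => u n * v n) atTop (𝓝 D))
    (hvs : Tendsto v atTop (𝓝 s)) : 0 < s ∧ Tendsto u atTop (𝓝 (D / s)) := by
  have hs : 0 < s := hD.trans_le <| le_of_tendsto_of_tendsto' huv hvs fun n =>
    mul_le_of_le_one_left (hv n) (hu n)
  refine ⟨hs, (huv.div hvs hs.ne').congr' ?_⟩
  filter_upwards [hvs.eventually_ne hs.ne'] with n hn
  exact mul_div_cancel_right₀ _ hn

end Extrema

section FrameMeasure

variable {G H : Type*} [NormedAddCommGroup H] [InnerProductSpace ℂ H] {π : G → H ≃ₗᵢ[ℂ] H}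
  {g : H} {Λ E : Set G} {B c : ℝ}

theorem IsDualFrame.frameAverage_mem_Icc (hd : IsDualFrame π g Λ (canonicalDual π g Λ) B)
    (hfin : (Λ ∩ E).Finite) : frameAverage π g Λ E ∈ Set.Icc 0 1 := by
  rw [frameAverage, finsum_mem_eq_finite_toFinset_sum _ hfin, Set.ncard_eq_toFinset_card _ hfin]
  have hmem {l : G} (hl : l ∈ hfin.toFinset) :=
    hd.re_inner_mem_Icc l (hfin.mem_toFinset.1 hl).1
  refine ⟨mul_nonneg (by positivity) (Finset.sum_nonneg fun l hl => (hmem hl).1),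
    inv_mul_le_one_of_le₀ ?_ (Nat.cast_nonneg _)⟩
  simpa using Finset.sum_le_card_nsmul hfin.toFinset _ 1 fun l hl => (hmem hl).2

variable [Group G] [MeasurableSpace G] {μ : Measure G}

theorem frameAverage_mul_pointDensity {K : Set G} {x : G} (hfin : (Λ ∩ x • K).Finite) :
    frameAverage π g Λ (x • K) * pointDensity μ Λ K x =
      localTrace π g (canonicalDual π g Λ) Λ (x • K) / μ.real K := by
  rw [frameAverage, pointDensity, localTrace]
  rcases (Λ ∩ x • K).eq_empty_or_nonempty with h | h
  · simp [h]
  · have := (Set.ncard_pos hfin).2 h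
    field_simp

variable [TopologicalSpace G] [IsTopologicalGroup G] [T2Space G] [BorelSpace G]
  [IsFiniteMeasureOnCompacts μ] [μ.IsMulLeftInvariant] [μ.IsInvInvariant] {K : ℕ → Set G}

theorem IsDualFrame.frameMeasures (hπ : IsProjectiveRep π) (hg : g ≠ 0)
    (hc : IsAdmissible μ π g c) (hd : IsDualFrame π g Λ (canonicalDual π g Λ) B)
    (hΛ : IsRelativelySeparated Λ) (hΛc : Λ.Countable)
    (hL : ∀ ε > 0, ∃ L, IsEssentialSupport μ Λ (coeff π g g) L ε) (hK : IsStrongFolner μ K) :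
    0 < lowerDensity μ Λ ∧
      HasLowerFrameMeasure π g Λ K (‖g‖ ^ 2 / c / upperDensity μ Λ) ∧
      HasUpperFrameMeasure π g Λ K (‖g‖ ^ 2 / c / lowerDensity μ Λ) := by
  have hfin (n : ℕ) (x : G) : (Λ ∩ x • K n).Finite := hΛ.finite ((hK.isCompact n).smul x)
  have havg (n : ℕ) (x : G) := hd.frameAverage_mem_Icc (hfin n x)
  have hdens (n : ℕ) (x : G) : 0 ≤ pointDensity μ Λ (K n) x := pointDensity_nonneg _ _
  have hD : 0 < ‖g‖ ^ 2 / c := div_pos (by positivity) hc.pos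
  have htrace := hd.tendstoUniformly_localTrace_div hπ hc hΛ hΛc hL hK
  simp only [← frameAverage_mul_pointDensity (hfin _ _)] at htrace
  have hlower := tendsto_iInf_mul_iSup (fun n x => (havg n x).1) hdens
    (fun n => hΛ.bddAbove_pointDensity (hK.isCompact n)) htrace
  have hupper := tendsto_iInf_mul_iSup hdens (fun n x => (havg n x).1)
    (fun n => ⟨1, Set.forall_mem_range.2 fun x => (havg n x).2⟩)
    (by simpa only [mul_comm (pointDensity _ _ _ _)] using htrace)
  simp only [mul_comm (⨅ _, pointDensity _ _ _ _)] at hupper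
  obtain ⟨-, hlower⟩ := tendsto_div_of_tendsto_mul hD
    (fun n => (ciInf_le ⟨0, Set.forall_mem_range.2 fun x => (havg n x).1⟩ 1).trans (havg n 1).2)
    (fun n => Real.iSup_nonneg (hdens n)) hlower (hΛ.tendsto_iSup_pointDensity hΛc hK)
  obtain ⟨hpos, hupper⟩ := tendsto_div_of_tendsto_mul hD (fun n => ciSup_le fun x => (havg n x).2)
    (fun n => Real.iInf_nonneg (hdens n)) hupper (hΛ.tendsto_iInf_pointDensity hΛc hK)
  exact ⟨hpos, hlower, hupper⟩

theorem IsRelativelySeparated.eventually_forall_nonempty (hΛ : IsRelativelySeparated Λ)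
    (hΛc : Λ.Countable) (hpos : 0 < lowerDensity μ Λ) (hK : IsStrongFolner μ K) :
    ∀ᶠ n in atTop, ∀ x : G, (Λ ∩ x • K n).Nonempty := by
  filter_upwards [(hΛ.tendsto_iInf_pointDensity hΛc hK).eventually_const_lt hpos] with n hn x
  rw [Set.nonempty_iff_ne_empty]
  intro hempty
  have hx := hn.trans_le (ciInf_le (bddBelow_pointDensity (K n)) x)
  simp [pointDensity, hempty] at hx

end FrameMeasure

theorem memLp_of_memLp_localMax {G : Type*} [Group G] [MeasurableSpace G] [MeasurableMul₂ G]
    [MeasurableInv G] {μ : Measure G} [SFinite μ] [μ.IsMulRightInvariant] {Q P : Set G}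
    (hP : MeasurableSet P) (hPQ : P ⊆ Q) (hμP : μ P ≠ 0) {F : G → ℂ} (hF : StronglyMeasurable F)
    (hM : MemLp (localMax μ Q F) 2 μ) : MemLp F 2 μ := by
  obtain ⟨m, -, hm_fin, hm⟩ := exists_isLocallyDominated_of_memLp_localMax hP hPQ hF hM
  exact (memLp_two_iff_lintegral_sq_enorm hF.aestronglyMeasurable).2
    ((hm.lintegral_le hμP).trans_lt hm_fin.lt_top)

theorem corollary3p3_general {G : Type*} [Group G] [TopologicalSpace G] [IsTopologicalGroup G]
    [T2Space G] [LocallyCompactSpace G] [SecondCountableTopology G] [MeasurableSpace G]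
    [BorelSpace G] (μ : Measure G) [μ.IsHaarMeasure] [μ.IsMulRightInvariant] {Q : Set G}
    (hQ : Q ∈ 𝓝 1) {H : Type*} [NormedAddCommGroup H] [InnerProductSpace ℂ H] [CompleteSpace H]
    {π : G → H ≃ₗᵢ[ℂ] H} (hπ : IsProjectiveRep π) (hirr : IsIrreducibleRep π) {g : H}
    (hg_ne : g ≠ 0) (hg : MemLp (localMax μ Q (coeff π g g)) 2 μ) {Λ : Set G}
    (hframe : IsCoherentFrame π g Λ) :
    ∃ Mlow Mup : ℝ, ∀ K : ℕ → Set G, IsStrongFolner μ K →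
      (∀ᶠ n in atTop, ∀ x : G, (Λ ∩ x • K n).Finite ∧ (Λ ∩ x • K n).Nonempty) ∧
      HasLowerFrameMeasure π g Λ K Mlow ∧ HasUpperFrameMeasure π g Λ K Mup := by
  have := isInvInvariant_of_isMulRightInvariant μ
  have hF := hπ.stronglyMeasurable_coeff g g
  obtain ⟨P, hP, hPQ, hPc⟩ := local_compact_nhds hQ
  have hPm := hPc.measurableSet
  have hμP : μ P ≠ 0 := (Measure.measure_pos_of_mem_nhds μ hP).ne'
  obtain ⟨m, hm, hm_fin, hdom⟩ := exists_isLocallyDominated_of_memLp_localMax hPm hPQ hF hg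
  obtain ⟨c, hc⟩ := hπ.exists_isAdmissible hirr hg_ne (memLp_of_memLp_localMax hPm hPQ hμP hF hg)
  obtain ⟨B, hd⟩ := hframe.exists_isDualFrame
  have hΛc := hπ.countable_of_isBessel hg_ne hd.bessel
  have hΛ := hπ.isRelativelySeparated_of_isBessel hg_ne hc hd.bessel
  refine ⟨‖g‖ ^ 2 / c / upperDensity μ Λ, ‖g‖ ^ 2 / c / lowerDensity μ Λ, fun K hK => ?_⟩
  obtain ⟨hpos, hlow, hup⟩ := hd.frameMeasures hπ hg_ne hc hΛ hΛc
    (fun ε hε => hdom.exists_isEssentialSupport hPc hP hm hm_fin hΛ hΛc hε) hK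
  refine ⟨?_, hlow, hup⟩
  filter_upwards [hΛ.eventually_forall_nonempty hΛc hpos hK] with n hn x
  exact ⟨hΛ.finite ((hK.isCompact n).smul x), hn x⟩

end CoherentFrame

theorem corollary3p3 {G : Type*} [Group G] [TopologicalSpace G] [IsTopologicalGroup G]
    [T2Space G] [LocallyCompactSpace G] [SecondCountableTopology G]
    [MeasurableSpace G] [BorelSpace G]
    (μ : Measure G) [μ.IsHaarMeasure] [μ.IsMulRightInvariant]
    (Q : Set G) (hQ_compact : IsCompact Q) (hQ_symm : Q⁻¹ = Q) (hQ_nhds : Q ∈ 𝓝 (1 : G))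
    {H : Type*} [NormedAddCommGroup H] [InnerProductSpace ℂ H] [CompleteSpace H]
    (π : G → H ≃ₗᵢ[ℂ] H) (hπ : CoherentFrame.IsDiscreteSeries μ π)
    (g : H) (hg_ne : g ≠ 0) (hg : g ∈ CoherentFrame.B2 μ Q π)
    (Λ : Set G) (hΛ : IsDiscrete Λ) (hframe : CoherentFrame.IsCoherentFrame π g Λ) :
    ∃ Mlow Mup : ℝ, ∀ K : ℕ → Set G, CoherentFrame.IsStrongFolner μ K →
      (∀ᶠ n in atTop, ∀ x : G, (Λ ∩ x • K n).Finite ∧ (Λ ∩ x • K n).Nonempty) ∧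
      CoherentFrame.HasLowerFrameMeasure π g Λ K Mlow ∧
      CoherentFrame.HasUpperFrameMeasure π g Λ K Mup :=
  CoherentFrame.corollary3p3_general μ hQ_nhds hπ.projective hπ.irreducible hg_ne hg.2 hframe
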